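/- Let $(\mathcal X,d,\mu)$ be a space of homogeneous type: a nonempty metric space with a non-negative Borel measure such that, for some $C_0$, $\mu(B(x,2r))\le C_0\,\mu(B(x,r))<\infty$ for all $x\in\mathcal X$, $r>0$. For a ball $B=B(x,r)$ put $\lambda B=B(x,\lambda r)$ and $C_j(B)=2^{j+1}B\setminus 2^jB$ for $j\ge2$; write $-\!\!\!\!\!\!\int_B h\,d\mu=\frac1{\mu(B)}\int_B h\,d\mu$ and $-\!\!\!\!\!\!\int_{C_j(B)}h\,d\mu=\frac1{\mu(2^{j+1}B)}\int_{C_j(B)}h\,d\mu$, and $\Upsilon(s)=\max\{s,s^{-1}\}$. Let $\mathbb B$ be a Banach space of measurable (real or complex valued) functions, identified when equal $\mu$-a.e., stable under multiplication by indicator functions of measurable sets and containing all simple functions supported in sets of finite measure. Let $T_t\in\mathcal L(\mathbb B)$, $t>0$, be linear with $T_sT_t=T_{s+t}$ for $s,t>0$. For $1\le p\le q\le\infty$ write $T_t\in\mathcal O(L^p-L^q)$ if there are $\theta_1,\theta_2,c,C>0$ such that for all $t>0$, all balls $B$ of radius $r$, all $f\in\mathbb B\cap L^p(\mu)$ and all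 $j\ge2$, $$\Big(-\!\!\!\!\!\!\int_B|T_t(\chi_Bf)|^q d\mu\Big)^{1/q}\le C\,\Upsilon\big(\tfrac r{\sqrt t}\big)^{\theta_2}\Big(-\!\!\!\!\!\!\int_B|f|^p d\mu\Big)^{1/p},$$ $$\Big(-\!\!\!\!\!\!\int_B|T_t(\chi_{C_j(B)}f)|^q d\mu\Big)^{1/q}\le C\,2^{j\theta_1}\Upsilon\big(\tfrac{2^jr}{\sqrt t}\big)^{\theta_2}e^{-c4^jr^2/t}\Big(-\!\!\!\!\!\!\int_{C_j(B)}|f|^p d\mu\Big)^{1/p},$$ $$\Big(-\!\!\!\!\!\!\int_{C_j(B)}|T_t(\chi_Bf)|^q d\mu\Big)^{1/q}\le C\,2^{j\theta_1}\Upsilon\big(\tfrac{2^jr}{\sqrt t}\big)^{\theta_2}e^{-c4^jr^2/t}\Big(-\!\!\!\!\!\!\int_B|f|^p d\mu\Big)^{1/p},$$ with essential suprema when an exponent is $\infty$. Assume that $T_t\in\mathcal O(L^{\tilde p}-L^{\tilde q})$ for some $1\le\tilde p<\tilde q\le\infty$, and let $\mathcal J(\mathcal T)\subset[1,\infty]$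 be the set of all exponents that belong to some pair $p<q$ in $[1,\infty]$ with $T_t\in\mathcal O(L^p-L^q)$. (This is the only set $J\subset[1,\infty]$ that can satisfy: for all $1\le p<q\le\infty$, $T_t\in\mathcal O(L^p-L^q)$ if and only if $p,q\in J$.) For finite $p\ge 1$, say that $(T_t)_{t>0}$ is strongly continuous on $L^p(\mu)$ if there is a semigroup $(S_t)_{t>0}$ of bounded linear operators on $L^p(\mu)$ with $S_tf=T_tf$ for all $t>0$ and all $f\in\mathbb B\cap\bigcap_{1\le s\le\infty}L^s(\mu)$ (a dense subspace of $L^p(\mu)$, so that $(S_t)$ is unique), and with $S_tf\to f$ in $L^p(\mu)$ as $t\to0^+$ for every $f\in L^p(\mu)$. Proposition. If $(T_t)_{t>0}$ is strongly continuous on $L^r(\mu)$ for some $r\in\mathcal J(\mathcal T)$, $r\ne\infty$, then it is strongly continuous on $L^p(\mu)$ for every $p\in\mathcal J(\mathcal T)$, $p\ne\infty$. In particular, on each of these $L^p(\mu)$ its extension $(S_t)_{t>0}$ has an infinitesimal generator $A$, a closed and densely defined operator: $f\in D(A)$ and $Af=g$ if and only if $\frac{S_tf-f}{t}\to g$ in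 $L^p(\mu)$ as $t\to0^+$. -/

import Mathlib

open MeasureTheory Filter Topology Set
open scoped ENNReal NNReal

namespace OffDiag

section Setting

/-- The doubling condition `μ(B(x,2r)) ≤ C₀ μ(B(x,r)) < ∞` for all balls. A nonempty metric space
with a Borel measure satisfying it is a space of homogeneous type. -/
def IsDoubling {X : Type*} [MetricSpace X] [MeasurableSpace X] (μ : Measure X) : Prop :=
  ∃ C₀ : ℝ≥0, ∀ (x : X) (r : ℝ), 0 < r →
    μ (Metric.ball x (2 * r)) ≤ C₀ * μ (Metric.ball x r) ∧ μ (Metric.ball x r) < ∞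

/-- The annulus `C_j(B) = 2^{j+1} B \ 2^j B` for `B = B(x,r)` (used for `j ≥ 2`). -/
def annulus {X : Type*} [MetricSpace X] (x : X) (r : ℝ) (j : ℕ) : Set X :=
  Metric.ball x (2 ^ (j + 1) * r) \ Metric.ball x (2 ^ j * r)

/-- `(1/μ(F) ∫_E |h|^q dμ)^{1/q}`, and the essential supremum of `|h|` on `E` if `q = ∞`
(for `0 < μ F < ∞`; here `E ⊆ F` and `F` is a ball). -/
noncomputable def avgNorm {X 𝕜 : Type*} [MeasurableSpace X] [RCLike 𝕜] (μ : Measure X)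
    (q : ℝ≥0∞) (F E : Set X) (h : X → 𝕜) : ℝ≥0∞ :=
  eLpNorm h q ((μ F)⁻¹ • μ.restrict E)

/-- `max {s, s⁻¹}`. -/
noncomputable def ups (s : ℝ) : ℝ := max s s⁻¹

end Setting

/-- `B` is a Banach space of (classes modulo `μ`-null sets of) measurable functions, stable under
truncation by indicator functions of measurable sets and containing the (integrable) simple
functions. The norm of `B` is the one carried by the type `B`; `toFun` is the inclusion. -/
structure FunctionSpace {X : Type*} [MeasurableSpace X] (𝕜 : Type*) [RCLike 𝕜] (μ : Measure X)
    (B : Type*) [NormedAddCommGroup B] [NormedSpace 𝕜 B] where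
  toFun : B →ₗ[𝕜] (X →ₘ[μ] 𝕜)
  injective : Function.Injective toFun
  /-- Stability under truncation. -/
  exists_trunc : ∀ (E : Set X), MeasurableSet E → ∀ f : B,
    ∃ g : B, toFun g =ᵐ[μ] E.indicator (toFun f)
  /-- Indicators of sets of finite measure (hence all simple functions supported in sets of finite
  measure, by linearity) belong to the space. -/
  exists_simple : ∀ (E : Set X), MeasurableSet E → μ E < ∞ →
    ∃ g : B, toFun g =ᵐ[μ] E.indicator (fun _ => (1 : 𝕜))

namespace FunctionSpace

variable {X : Type*} [MeasurableSpace X] {𝕜 : Type*} [RCLike 𝕜] {μ : Measure X}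
  {B : Type*} [NormedAddCommGroup B] [NormedSpace 𝕜 B]

/-- The truncation `χ_E f`, an element of `B` for measurable `E`. -/
noncomputable def trunc (ι : FunctionSpace 𝕜 μ B) {E : Set X} (hE : MeasurableSet E) (f : B) : B :=
  (ι.exists_trunc E hE f).choose

theorem trunc_spec (ι : FunctionSpace 𝕜 μ B) {E : Set X} (hE : MeasurableSet E) (f : B) :
    ι.toFun (ι.trunc hE f) =ᵐ[μ] E.indicator (ι.toFun f) :=
  (ι.exists_trunc E hE f).choose_spec

end FunctionSpace

theorem measurableSet_annulus {X : Type*} [MetricSpace X] [MeasurableSpace X] [BorelSpace X]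
    (x : X) (r : ℝ) (j : ℕ) : MeasurableSet (annulus x r j) :=
  measurableSet_ball.diff measurableSet_ball

section Family

variable {X : Type*} [MetricSpace X] [MeasurableSpace X] [BorelSpace X]
  {𝕜 : Type*} [RCLike 𝕜] {μ : Measure X}
  {B : Type*} [NormedAddCommGroup B] [NormedSpace 𝕜 B]

/-- `T_t ∈ O(L^p - L^q)`: the family `(T_t)_{t>0}` satisfies `L^p(μ)-L^q(μ)` off-diagonal estimates
on balls. The functions `f` range over `B ∩ L^p(μ)`; only the values `T t`, `t > 0`, matter. -/
def OffDiagonal (ι : FunctionSpace 𝕜 μ B) (T : ℝ → B →L[𝕜] B) (p q : ℝ≥0∞) : Prop :=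
  ∃ θ₁ θ₂ c C : ℝ, 0 < θ₁ ∧ 0 < θ₂ ∧ 0 < c ∧ 0 < C ∧
    ∀ t : ℝ, 0 < t → ∀ (x : X) (r : ℝ), 0 < r → ∀ f : B, MemLp (ι.toFun f) p μ →
      avgNorm μ q (Metric.ball x r) (Metric.ball x r)
          (ι.toFun (T t (ι.trunc (measurableSet_ball (x := x) (ε := r)) f))) ≤
        ENNReal.ofReal (C * ups (r / √t) ^ θ₂) *
          avgNorm μ p (Metric.ball x r) (Metric.ball x r) (ι.toFun f) ∧
      ∀ j : ℕ, 2 ≤ j →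
        avgNorm μ q (Metric.ball x r) (Metric.ball x r)
            (ι.toFun (T t (ι.trunc (measurableSet_annulus x r j) f))) ≤
          ENNReal.ofReal (C * (2 : ℝ) ^ (j * θ₁) * ups (2 ^ j * r / √t) ^ θ₂ *
              Real.exp (-(c * 4 ^ j * r ^ 2 / t))) *
            avgNorm μ p (Metric.ball x (2 ^ (j + 1) * r)) (annulus x r j) (ι.toFun f) ∧
        avgNorm μ q (Metric.ball x (2 ^ (j + 1) * r)) (annulus x r j)
            (ι.toFun (T t (ι.trunc (measurableSet_ball (x := x) (ε := r)) f))) ≤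
          ENNReal.ofReal (C * (2 : ℝ) ^ (j * θ₁) * ups (2 ^ j * r / √t) ^ θ₂ *
              Real.exp (-(c * 4 ^ j * r ^ 2 / t))) *
            avgNorm μ p (Metric.ball x r) (Metric.ball x r) (ι.toFun f)

/-- The defining property of the set `J(T)` of a semigroup: a subset `J` of `[1,∞]` such that,
for `1 ≤ p < q ≤ ∞`, one has `T_t ∈ O(L^p - L^q)` if and only if `p, q ∈ J`. -/
def IsOffDiagonalSet (ι : FunctionSpace 𝕜 μ B) (T : ℝ → B →L[𝕜] B) (J : Set ℝ≥0∞) : Prop :=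
  J ⊆ Icc 1 ∞ ∧ ∀ p q : ℝ≥0∞, 1 ≤ p → p < q → (OffDiagonal ι T p q ↔ p ∈ J ∧ q ∈ J)

/-- The set `J(T)`, built explicitly: the exponents which are one of the two exponents of some pair
`p < q` with `T_t ∈ O(L^p - L^q)`. By `IsOffDiagonalSet.eq_offDiagonalSet` this is the only set
that can have the property `IsOffDiagonalSet` (once there is one such pair). -/
def offDiagonalSet (ι : FunctionSpace 𝕜 μ B) (T : ℝ → B →L[𝕜] B) : Set ℝ≥0∞ :=
  {s | ∃ p q : ℝ≥0∞, 1 ≤ p ∧ p < q ∧ OffDiagonal ι T p q ∧ (s = p ∨ s = q)}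

theorem IsOffDiagonalSet.eq_offDiagonalSet {ι : FunctionSpace 𝕜 μ B} {T : ℝ → B →L[𝕜] B}
    {J : Set ℝ≥0∞} (hJ : IsOffDiagonalSet ι T J) {p₀ q₀ : ℝ≥0∞} (hp₀ : 1 ≤ p₀) (hpq : p₀ < q₀)
    (h₀ : OffDiagonal ι T p₀ q₀) : J = offDiagonalSet ι T := by
  obtain ⟨hp, hq⟩ := (hJ.2 p₀ q₀ hp₀ hpq).1 h₀
  ext s
  constructor
  · intro hs
    obtain ⟨u, hu, hne⟩ : ∃ u ∈ J, u ≠ s := by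
      by_cases h : p₀ = s
      · exact ⟨q₀, hq, fun h' => hpq.ne (h.trans h'.symm)⟩
      · exact ⟨p₀, hp, h⟩
    rcases lt_or_gt_of_ne hne with h | h
    · exact ⟨u, s, (hJ.1 hu).1, h, (hJ.2 u s (hJ.1 hu).1 h).2 ⟨hu, hs⟩, Or.inr rfl⟩
    · exact ⟨s, u, (hJ.1 hs).1, h, (hJ.2 s u (hJ.1 hs).1 h).2 ⟨hs, hu⟩, Or.inl rfl⟩
  · rintro ⟨p, q, h1, h2, h3, rfl | rfl⟩
    · exact ((hJ.2 _ _ h1 h2).1 h3).1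
    · exact ((hJ.2 _ _ h1 h2).1 h3).2

end Family

section Semigroup

variable {𝕜 : Type*} [RCLike 𝕜] {E : Type*} [NormedAddCommGroup E] [NormedSpace 𝕜 E]

/-- `(S_t)_{t>0}` is a semigroup of bounded linear operators. -/
def IsSemigroup (S : ℝ → E →L[𝕜] E) : Prop :=
  ∀ s t : ℝ, 0 < s → 0 < t → (S s).comp (S t) = S (s + t)

/-- Continuity at `0` for the strong operator topology. -/
def StronglyContinuousAtZero (S : ℝ → E →L[𝕜] E) : Prop :=
  ∀ f : E, Tendsto (fun t : ℝ => S t f) (𝓝[>] 0) (𝓝 f)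

/-- The operator `A`, with its domain, is the infinitesimal generator of `(S_t)_{t>0}`:
`f ∈ D(A)` and `A f = g` if and only if `(S_t f - f) / t → g` in norm as `t → 0⁺`. -/
def IsGenerator (S : ℝ → E →L[𝕜] E) (A : E →ₗ.[𝕜] E) : Prop :=
  ∀ f g : E, (f, g) ∈ A.graph ↔
    Tendsto (fun t : ℝ => ((t : 𝕜)⁻¹) • (S t f - f)) (𝓝[>] 0) (𝓝 g)

end Semigroup

section LpExtension

variable {X : Type*} [MeasurableSpace X] {𝕜 : Type*} [RCLike 𝕜] {μ : Measure X}
  {B : Type*} [NormedAddCommGroup B] [NormedSpace 𝕜 B]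

/-- The functions of `B` that lie in all the spaces `L^s(μ)`, `1 ≤ s ≤ ∞`. It contains the
(integrable) simple functions, hence is dense in `L^p(μ)` for every finite `p ≥ 1`. -/
def core (ι : FunctionSpace 𝕜 μ B) : Set B :=
  {f | ∀ s : ℝ≥0∞, 1 ≤ s → MemLp (ι.toFun f) s μ}

/-- `(S_t)_{t>0}`, bounded operators on `L^p(μ)`, is the extension by density of `(T_t)_{t>0}`
to `L^p(μ)`: `S_t f = T_t f` for `t > 0` and `f ∈ B` lying in all Lebesgue spaces. -/
def IsLpExtension (ι : FunctionSpace 𝕜 μ B) (T : ℝ → B →L[𝕜] B) (p : ℝ≥0∞) [Fact (1 ≤ p)]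
    (S : ℝ → Lp 𝕜 p μ →L[𝕜] Lp 𝕜 p μ) : Prop :=
  ∀ t : ℝ, 0 < t → ∀ f ∈ core ι, ∀ g : Lp 𝕜 p μ, (g : X →ₘ[μ] 𝕜) = ι.toFun f →
    (S t g : X →ₘ[μ] 𝕜) = ι.toFun (T t f)

/-- `(S_t)_{t>0}` is a strongly continuous semigroup on `L^p(μ)` extending `(T_t)_{t>0}`. -/
structure IsStronglyContinuousExtension (ι : FunctionSpace 𝕜 μ B) (T : ℝ → B →L[𝕜] B)
    (p : ℝ≥0∞) [Fact (1 ≤ p)] (S : ℝ → Lp 𝕜 p μ →L[𝕜] Lp 𝕜 p μ) : Prop where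
  isLpExtension : IsLpExtension ι T p S
  isSemigroup : IsSemigroup S
  stronglyContinuous : StronglyContinuousAtZero S

end LpExtension

end OffDiag

/-! Let `U` be the given semigroup on `L^r`, and let `p` be an endpoint of a pair with an
off-diagonal estimate. Approximation by simple functions and Fatou carry the estimates from `T` to
`U` (`OffDiagonal.offDiagonalLp`). The estimates are averaged, so Hölder gives them for every larger
source exponent and every smaller target exponent. In particular `U` satisfies `L^p`-`L^p`
estimates.

At scale `√t` these give a bound on `L^p` uniform in `t` (`OffDiagonalLp.exists_eLpNorm_le`): `f` is
cut into dyadic annuli around each ball of a net, Gaussian decay beats the loss in `j`, and doubling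
controls the overlaps. Hence `U t` extends from `L^p ∩ L^r` to `S t` on `L^p`, and the semigroup law
follows by density. By uniform boundedness the vectors `g` with `S t g → g` form a closed subspace,
so it suffices to treat `g` of bounded support lying in every Lebesgue space.

If `p ≤ r`, Hölder on a fixed enlarged ball turns `L^r` convergence into `L^p` convergence there,
and the off-diagonal decay makes the rest vanish. If `p > r` and `p` is the lower endpoint of a pair
`p < q`, the claim follows by interpolating between convergence in `L^r` and boundedness in `L^q`.

The delicate case is `p > r` with `p` the upper endpoint of a pair `a < p`, since no larger exponent
need be available. Convergence holds in `L^a` by the previous arguments. The smoothing of `S s` from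
`L^a` to `L^p` then puts `S s g` in the continuity subspace for each `s > 0`. Along some sequence `t
n → 0`, `S (t n) g` is bounded in `L^p` and tends to `g` almost everywhere. Since `1 < p < ∞`, a
Banach–Saks argument (`mem_of_tendsto_ae_of_bounded`) shows that the closed subspace contains `g`.

The generator statement is the classical theory of bounded strongly continuous semigroups
(`exists_generator`). -/

namespace OffDiag

/-! ### Generators of bounded strongly continuous semigroups -/

section Generator

variable {𝕜 : Type*} [RCLike 𝕜] {E : Type*} [NormedAddCommGroup E] [NormedSpace 𝕜 E]

/-- The family `S` on `(0,∞)`, extended by the identity to the whole line. -/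
noncomputable def orbit (S : ℝ → E →L[𝕜] E) (t : ℝ) : E →L[𝕜] E :=
  if 0 < t then S t else ContinuousLinearMap.id 𝕜 E

theorem orbit_of_pos {S : ℝ → E →L[𝕜] E} {t : ℝ} (ht : 0 < t) : orbit S t = S t := if_pos ht

theorem orbit_of_nonpos {S : ℝ → E →L[𝕜] E} {t : ℝ} (ht : t ≤ 0) (f : E) : orbit S t f = f := by
  simp [orbit, not_lt.2 ht]

theorem orbit_add {S : ℝ → E →L[𝕜] E} (hS : IsSemigroup S) {s t : ℝ} (hs : 0 ≤ s) (ht : 0 ≤ t)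
    (f : E) : orbit S (s + t) f = orbit S s (orbit S t f) := by
  rcases hs.eq_or_lt with rfl | hs
  · simp [orbit_of_nonpos le_rfl]
  rcases ht.eq_or_lt with rfl | ht
  · simp [orbit_of_nonpos le_rfl]
  rw [orbit_of_pos hs, orbit_of_pos ht, orbit_of_pos (add_pos hs ht), ← hS s t hs ht]
  rfl

theorem orbit_max (S : ℝ → E →L[𝕜] E) (t : ℝ) (f : E) : orbit S (max t 0) f = orbit S t f := by
  rcases le_total t 0 with h | h
  · rw [max_eq_right h, orbit_of_nonpos le_rfl, orbit_of_nonpos h]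
  · rw [max_eq_left h]

theorem norm_orbit_le {S : ℝ → E →L[𝕜] E} {C : ℝ} (hC : 1 ≤ C)
    (hb : ∀ t, 0 < t → ∀ f, ‖S t f‖ ≤ C * ‖f‖) (t : ℝ) (f : E) : ‖orbit S t f‖ ≤ C * ‖f‖ := by
  rcases le_or_gt t 0 with h | h
  · rw [orbit_of_nonpos h]; exact le_mul_of_one_le_left (norm_nonneg _) hC
  · rw [orbit_of_pos h]; exact hb t h f

theorem tendsto_orbit_zero {S : ℝ → E →L[𝕜] E} (hc : StronglyContinuousAtZero S) (f : E) :
    Tendsto (fun t => orbit S t f) (𝓝 0) (𝓝 f) := by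
  rw [← nhdsLE_sup_nhdsGT (0 : ℝ), tendsto_sup]
  constructor
  · refine tendsto_const_nhds.congr' ?_
    filter_upwards [self_mem_nhdsWithin] with t ht
    rw [orbit_of_nonpos ht]
  · refine (hc f).congr' ?_
    filter_upwards [self_mem_nhdsWithin] with t ht
    rw [orbit_of_pos ht]

theorem norm_orbit_sub_le {S : ℝ → E →L[𝕜] E} (hS : IsSemigroup S) {C : ℝ} (hC : 1 ≤ C)
    (hb : ∀ t, 0 < t → ∀ f, ‖S t f‖ ≤ C * ‖f‖) {a b : ℝ} (ha : 0 ≤ a) (hab : a ≤ b) (f : E) :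
    ‖orbit S b f - orbit S a f‖ ≤ C * ‖orbit S |b - a| f - f‖ := by
  have h : orbit S b f = orbit S a (orbit S (b - a) f) := by
    rw [← orbit_add hS ha (sub_nonneg.2 hab)]; ring_nf
  rw [h, ← map_sub, abs_of_nonneg (sub_nonneg.2 hab)]
  exact norm_orbit_le hC hb _ _

theorem continuous_orbit {S : ℝ → E →L[𝕜] E} (hS : IsSemigroup S)
    (hc : StronglyContinuousAtZero S) {C : ℝ} (hC : 1 ≤ C)
    (hb : ∀ t, 0 < t → ∀ f, ‖S t f‖ ≤ C * ‖f‖) (f : E) :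
    Continuous fun t => orbit S t f := by
  have key : ∀ a b : ℝ, ‖orbit S b f - orbit S a f‖ ≤
      C * ‖orbit S |max b 0 - max a 0| f - f‖ := by
    intro a b
    rw [← orbit_max S a, ← orbit_max S b]
    rcases le_total (max a 0) (max b 0) with h | h
    · exact norm_orbit_sub_le hS hC hb (le_max_right _ _) h f
    · rw [norm_sub_rev, abs_sub_comm]
      exact norm_orbit_sub_le hS hC hb (le_max_right _ _) h f
  refine continuous_iff_continuousAt.2 fun a => ?_
  rw [ContinuousAt, tendsto_iff_norm_sub_tendsto_zero]
  refine squeeze_zero (fun _ => norm_nonneg _) (key a) ?_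
  have h1 : Tendsto (fun b : ℝ => |max b 0 - max a 0|) (𝓝 a) (𝓝 0) := by
    have : Continuous fun b : ℝ => |max b 0 - max a 0| := by fun_prop
    simpa using this.tendsto a
  have h2 := (tendsto_iff_norm_sub_tendsto_zero.1 (tendsto_orbit_zero hc f)).comp h1
  simpa using h2.const_mul C

variable [NormedSpace ℝ E] [IsScalarTower ℝ 𝕜 E]

theorem tendsto_quotient_iff_hasDerivWithinAt {S : ℝ → E →L[𝕜] E} (f g : E) :
    Tendsto (fun t : ℝ => ((t : 𝕜)⁻¹) • (S t f - f)) (𝓝[>] 0) (𝓝 g) ↔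
      HasDerivWithinAt (fun t => orbit S t f) g (Ioi 0) 0 := by
  rw [hasDerivWithinAt_iff_tendsto_slope' (by simp)]
  refine tendsto_congr' ?_
  filter_upwards [self_mem_nhdsWithin] with t ht
  rw [slope_def_module, orbit_of_pos ht, orbit_of_nonpos le_rfl, sub_zero,
    RCLike.real_smul_eq_coe_smul (K := 𝕜)]
  simp

/-- Pairs `(f, g)` such that `(S_t f - f) / t → g`. -/
def generatorGraph (S : ℝ → E →L[𝕜] E) : Submodule 𝕜 (E × E) where
  carrier := {z | Tendsto (fun t : ℝ => ((t : 𝕜)⁻¹) • (S t z.1 - z.1)) (𝓝[>] 0) (𝓝 z.2)}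
  zero_mem' := by simp
  add_mem' {a b} ha hb := by
    refine (Tendsto.add ha hb).congr fun t => ?_
    simp only [Prod.fst_add, map_add, ← smul_add]
    congr 1; abel
  smul_mem' c a ha := by
    refine (Tendsto.const_smul ha c).congr fun t => ?_
    simp only [Prod.smul_fst, map_smul, ← smul_sub]
    rw [smul_comm]

variable [CompleteSpace E]

/-- The integrated form of the differential equation `u' = S u g`. Unlike the limit of difference
quotients, it is an equation between expressions continuous in `z`, which is what makes the
generator closed. -/
theorem mem_generatorGraph_iff {S : ℝ → E →L[𝕜] E} (hS : IsSemigroup S)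
    (hc : StronglyContinuousAtZero S) {C : ℝ} (hC : 1 ≤ C)
    (hb : ∀ t, 0 < t → ∀ f, ‖S t f‖ ≤ C * ‖f‖) (z : E × E) :
    z ∈ generatorGraph S ↔
      ∀ h, 0 ≤ h → orbit S h z.1 - z.1 = ∫ u in (0 : ℝ)..h, orbit S u z.2 := by
  have hcont := continuous_orbit hS hc hC hb
  change Tendsto (fun t : ℝ => ((t : 𝕜)⁻¹) • (S t z.1 - z.1)) (𝓝[>] 0) (𝓝 z.2) ↔ _
  constructor
  · intro hz h hh
    rw [intervalIntegral.integral_eq_sub_of_hasDeriv_right (f := fun t => orbit S t z.1)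
      (hcont z.1).continuousOn _ ((hcont z.2).intervalIntegrable _ _), orbit_of_nonpos le_rfl]
    intro u hu
    rw [min_eq_left hh] at hu
    -- The right derivative at `u` is `S u` applied to the difference quotient at `0`; the
    -- fundamental theorem of calculus asks only for right derivatives.
    rw [hasDerivWithinAt_iff_tendsto_slope' (by simp)]
    have h1 : Tendsto (fun t : ℝ => t - u) (𝓝[>] u) (𝓝[>] 0) := by
      refine tendsto_nhdsWithin_iff.2 ⟨?_, ?_⟩
      · have : Tendsto (fun t : ℝ => t - u) (𝓝 u) (𝓝 (u - u)) :=
          (continuous_id.sub continuous_const).tendsto u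
        rw [sub_self] at this
        exact this.mono_left nhdsWithin_le_nhds
      · filter_upwards [self_mem_nhdsWithin] with t ht
        exact sub_pos.2 (mem_Ioi.1 ht)
    have h2 := (((orbit S u).continuous.tendsto z.2).comp hz).comp h1
    refine h2.congr' ?_
    filter_upwards [self_mem_nhdsWithin] with t ht
    have ht' : 0 < t - u := sub_pos.2 ht
    have : orbit S t z.1 = orbit S u (orbit S (t - u) z.1) := by
      rw [← orbit_add hS hu.1.le ht'.le]; ring_nf
    rw [slope_def_module, this, RCLike.real_smul_eq_coe_smul (K := 𝕜), orbit_of_pos ht']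
    simp
  · intro hz
    rw [tendsto_quotient_iff_hasDerivWithinAt]
    have h1 : HasDerivAt (fun h => ∫ u in (0 : ℝ)..h, orbit S u z.2) (orbit S 0 z.2) 0 :=
      intervalIntegral.integral_hasDerivAt_right ((hcont z.2).intervalIntegrable _ _)
        ((hcont z.2).stronglyMeasurableAtFilter _ _) (hcont z.2).continuousAt
    rw [orbit_of_nonpos le_rfl] at h1
    refine ((h1.const_add z.1).hasDerivWithinAt (s := Ioi 0)).congr (fun t ht => ?_) ?_
    · rw [← hz t (le_of_lt ht)]; abel
    · simp [orbit_of_nonpos]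

theorem isClosed_generatorGraph {S : ℝ → E →L[𝕜] E} (hS : IsSemigroup S)
    (hc : StronglyContinuousAtZero S) {C : ℝ} (hC : 1 ≤ C)
    (hb : ∀ t, 0 < t → ∀ f, ‖S t f‖ ≤ C * ‖f‖) :
    IsClosed (generatorGraph S : Set (E × E)) := by
  have : (generatorGraph S : Set (E × E)) = ⋂ h : ℝ, ⋂ _ : 0 ≤ h,
      {z : E × E | orbit S h z.1 - z.1 = ∫ u in (0 : ℝ)..h, orbit S u z.2} := by
    ext z
    simp [mem_generatorGraph_iff hS hc hC hb]
  rw [this]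
  refine isClosed_iInter fun h => isClosed_iInter fun hh => isClosed_eq (by fun_prop) ?_
  have hlip : LipschitzWith (Real.toNNReal (C * h))
      fun g : E => ∫ u in (0 : ℝ)..h, orbit S u g := by
    refine LipschitzWith.of_dist_le_mul fun g g' => ?_
    rw [dist_eq_norm, dist_eq_norm, Real.coe_toNNReal _ (by positivity),
      ← intervalIntegral.integral_sub ((continuous_orbit hS hc hC hb g).intervalIntegrable _ _)
        ((continuous_orbit hS hc hC hb g').intervalIntegrable _ _)]
    have := intervalIntegral.norm_integral_le_of_norm_le_const (a := 0) (b := h)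
      (f := fun u => orbit S u g - orbit S u g') (C := C * ‖g - g'‖) fun u _ => by
        rw [← map_sub]; exact norm_orbit_le hC hb _ _
    rw [sub_zero, abs_of_nonneg hh] at this
    linarith
  exact hlip.continuous.comp continuous_snd

theorem integral_orbit_mem_domain {S : ℝ → E →L[𝕜] E} (hS : IsSemigroup S)
    (hc : StronglyContinuousAtZero S) {C : ℝ} (hC : 1 ≤ C)
    (hb : ∀ t, 0 < t → ∀ f, ‖S t f‖ ≤ C * ‖f‖) (f : E) {h : ℝ} (hh : 0 ≤ h) :
    (∫ u in (0 : ℝ)..h, orbit S u f, orbit S h f - f) ∈ generatorGraph S := by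
  have hcont := continuous_orbit hS hc hC hb f
  change Tendsto (fun t : ℝ => ((t : 𝕜)⁻¹) • (S t (∫ u in (0 : ℝ)..h, orbit S u f) -
    ∫ u in (0 : ℝ)..h, orbit S u f)) (𝓝[>] 0) (𝓝 (orbit S h f - f))
  rw [tendsto_quotient_iff_hasDerivWithinAt]
  have hF : ∀ x : ℝ, HasDerivAt (fun y => ∫ u in (0 : ℝ)..y, orbit S u f) (orbit S x f) x :=
    fun x => intervalIntegral.integral_hasDerivAt_right (hcont.intervalIntegrable _ _)
      (hcont.stronglyMeasurableAtFilter _ _) hcont.continuousAt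
  have h1 : HasDerivAt (fun y => ∫ u in (0 : ℝ)..(y + h), orbit S u f) (orbit S h f) 0 :=
    HasDerivAt.comp_add_const 0 h (by simpa using hF h)
  have h2 := h1.sub (hF 0)
  rw [orbit_of_nonpos le_rfl] at h2
  refine (h2.hasDerivWithinAt (s := Ioi 0)).congr (fun t ht => ?_) ?_
  · have ht' : (0 : ℝ) < t := ht
    rw [← ContinuousLinearMap.intervalIntegral_comp_comm _ (hcont.intervalIntegrable _ _)]
    -- Applying `S t` shifts the interval of integration to `[t, t + h]`, so the difference quotient
    -- involves only the two end pieces.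
    have e1 : ∫ u in (0 : ℝ)..h, orbit S t (orbit S u f) =
        ∫ u in (0 : ℝ)..h, orbit S (u + t) f := by
      refine intervalIntegral.integral_congr fun u hu => ?_
      rw [uIcc_of_le hh] at hu
      rw [add_comm u t, orbit_add hS ht'.le hu.1]
    rw [e1, intervalIntegral.integral_comp_add_right (fun u => orbit S u f), zero_add, add_comm h t]
    simp only [Pi.sub_apply]
    rw [intervalIntegral.integral_interval_sub_left] <;> exact hcont.intervalIntegrable _ _
  · simp [orbit_of_nonpos]

theorem exists_generator {S : ℝ → E →L[𝕜] E} (hS : IsSemigroup S)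
    (hc : StronglyContinuousAtZero S) {C : ℝ} (hC : 1 ≤ C)
    (hb : ∀ t, 0 < t → ∀ f, ‖S t f‖ ≤ C * ‖f‖) :
    ∃ A : E →ₗ.[𝕜] E, IsGenerator S A ∧ Dense (A.domain : Set E) ∧ A.IsClosed := by
  have hgraph : ((generatorGraph S).toLinearPMap).graph = generatorGraph S := by
    refine Submodule.toLinearPMap_graph_eq _ fun z hz h0 => ?_
    have hz' : Tendsto (fun t : ℝ => ((t : 𝕜)⁻¹) • (S t z.1 - z.1)) (𝓝[>] 0) (𝓝 z.2) := hz
    simp only [h0, map_zero, sub_zero, smul_zero] at hz'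
    exact tendsto_nhds_unique hz' tendsto_const_nhds
  refine ⟨(generatorGraph S).toLinearPMap, ?_, ?_, ?_⟩
  · intro f g
    rw [hgraph]
    rfl
  · intro f
    have hcont := continuous_orbit hS hc hC hb f
    -- Density: the means of the orbit over `[0, t]` lie in the domain and tend to `f`.
    have h1 : HasDerivAt (fun y => ∫ u in (0 : ℝ)..y, orbit S u f) (orbit S 0 f) 0 :=
      intervalIntegral.integral_hasDerivAt_right (hcont.intervalIntegrable _ _)
        (hcont.stronglyMeasurableAtFilter _ _) hcont.continuousAt
    rw [orbit_of_nonpos le_rfl] at h1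
    have h2 := (hasDerivWithinAt_iff_tendsto_slope' (by simp)).1
      (h1.hasDerivWithinAt (s := Ioi 0))
    refine mem_closure_of_tendsto h2 ?_
    filter_upwards [self_mem_nhdsWithin] with t ht
    rw [slope_def_module, RCLike.real_smul_eq_coe_smul (K := 𝕜), intervalIntegral.integral_same,
      sub_zero (∫ u in (0 : ℝ)..t, orbit S u f)]
    refine Submodule.smul_mem _ _ ?_
    have := integral_orbit_mem_domain hS hc hC hb f (le_of_lt ht)
    rw [← hgraph] at this
    exact LinearPMap.mem_domain_of_mem_graph this
  · rw [LinearPMap.IsClosed, hgraph]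
    exact isClosed_generatorGraph hS hc hC hb

end Generator

/-! ### Truncation, Fatou and simple functions in `L^r` -/

section LpTools

variable {X : Type*} [MeasurableSpace X] {𝕜 : Type*} [RCLike 𝕜] {μ : Measure X}

theorem tendsto_eLpNorm_zero_of_dominated {p : ℝ≥0∞} (hp0 : p ≠ 0) (hp : p ≠ ∞)
    {F : ℕ → X → 𝕜} {G : X → 𝕜} (hF : ∀ n, AEStronglyMeasurable (F n) μ) (hG : MemLp G p μ)
    (hFG : ∀ n, ∀ᵐ x ∂μ, ‖F n x‖ ≤ ‖G x‖)
    (hlim : ∀ᵐ x ∂μ, Tendsto (fun n => F n x) atTop (𝓝 0)) :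
    Tendsto (fun n => eLpNorm (F n) p μ) atTop (𝓝 0) := by
  have hp' : 0 < p.toReal := ENNReal.toReal_pos hp0 hp
  have h1 : Tendsto (fun n => ∫⁻ x, ‖F n x‖ₑ ^ p.toReal ∂μ) atTop (𝓝 0) := by
    have := tendsto_lintegral_of_dominated_convergence' (μ := μ)
      (F := fun n x => ‖F n x‖ₑ ^ p.toReal) (f := fun _ => 0)
      (fun x => ‖G x‖ₑ ^ p.toReal) (fun n => (hF n).enorm.pow_const _)
      (fun n => (hFG n).mono fun x hx => by
        refine ENNReal.rpow_le_rpow ?_ hp'.le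
        exact enorm_le_iff_norm_le.2 hx)
      (lintegral_rpow_enorm_lt_top_of_eLpNorm_lt_top hp0 hp hG.2).ne
      (hlim.mono fun x hx => by
        have h2 : Tendsto (fun n => ‖F n x‖ₑ) atTop (𝓝 0) := by simpa using hx.enorm
        simpa [ENNReal.zero_rpow_of_pos hp'] using h2.ennrpow_const p.toReal)
    simpa using this
  simp only [eLpNorm_eq_lintegral_rpow_enorm_toReal hp0 hp]
  have h3 : (0 : ℝ) < 1 / p.toReal := by positivity
  simpa only [ENNReal.zero_rpow_of_pos h3] using h1.ennrpow_const (1 / p.toReal)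

theorem eLpNorm_le_of_measure_univ_le_one {p q : ℝ≥0∞} (hp : 1 ≤ p) (hpq : p ≤ q)
    (hμ : μ univ ≤ 1) {f : X → 𝕜} (hf : AEStronglyMeasurable f μ) :
    eLpNorm f p μ ≤ eLpNorm f q μ := by
  refine (eLpNorm_le_eLpNorm_mul_rpow_measure_univ hpq hf).trans ?_
  refine mul_le_of_le_one_right' (ENNReal.rpow_le_one hμ ?_)
  rcases eq_or_ne q ∞ with rfl | hq
  · simp
  have hp' : 0 < p.toReal :=
    ENNReal.toReal_pos (zero_lt_one.trans_le hp).ne' (ne_top_of_le_ne_top hq hpq)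
  exact sub_nonneg.2 (one_div_le_one_div_of_le hp' (ENNReal.toReal_mono hq hpq))

variable {r : ℝ≥0∞}

/-- Truncation of an element of `L^r`. -/
noncomputable def truncLp {E : Set X} (hE : MeasurableSet E) (f : Lp 𝕜 r μ) : Lp 𝕜 r μ :=
  ((Lp.memLp f).indicator hE).toLp _

theorem coeFn_truncLp {E : Set X} (hE : MeasurableSet E) (f : Lp 𝕜 r μ) :
    truncLp hE f =ᵐ[μ] E.indicator f :=
  MemLp.coeFn_toLp _

theorem truncLp_eq_zero {E : Set X} (hE : MeasurableSet E) (f : Lp 𝕜 r μ) :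
    ∀ᵐ x ∂μ, x ∉ E → truncLp hE f x = 0 := by
  filter_upwards [coeFn_truncLp hE f] with x hx h
  rw [hx, indicator_of_notMem h]

theorem eLpNorm_truncLp_le {E : Set X} (hE : MeasurableSet E) (f : Lp 𝕜 r μ) (p : ℝ≥0∞)
    {ν : Measure X} (hν : ν ≪ μ) : eLpNorm (truncLp hE f) p ν ≤ eLpNorm f p ν := by
  rw [eLpNorm_congr_ae (hν.ae_le (coeFn_truncLp hE f))]
  exact eLpNorm_indicator_le _

theorem truncLp_add_truncLp_of_disjoint {E F : Set X} (hE : MeasurableSet E)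
    (hF : MeasurableSet F) (hEF : Disjoint E F) (f : Lp 𝕜 r μ) :
    truncLp (hE.union hF) f = truncLp hE f + truncLp hF f := by
  apply Lp.ext
  filter_upwards [coeFn_truncLp hE f, coeFn_truncLp hF f, coeFn_truncLp (hE.union hF) f,
    Lp.coeFn_add (truncLp hE f) (truncLp hF f)] with x h1 h2 h3 h4
  rw [h3, h4, Pi.add_apply, h1, h2, indicator_union_of_disjoint hEF]

theorem truncLp_eq_self {E : Set X} (hE : MeasurableSet E) {f : Lp 𝕜 r μ}
    (hf : ∀ᵐ x ∂μ, x ∉ E → f x = 0) : truncLp hE f = f := by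
  apply Lp.ext
  filter_upwards [coeFn_truncLp hE f, hf] with x h1 h2
  rw [h1]
  by_cases hx : x ∈ E
  · rw [indicator_of_mem hx]
  · rw [indicator_of_notMem hx, h2 hx]

variable [Fact (1 ≤ r)]

theorem one_le_ne_zero : r ≠ 0 := (zero_lt_one.trans_le (Fact.out : 1 ≤ r)).ne'

theorem tendsto_truncLp (hr : r ≠ ∞) {E : ℕ → Set X} (hE : ∀ n, MeasurableSet (E n))
    (hlim : ∀ x, ∀ᶠ n in atTop, x ∈ E n) (f : Lp 𝕜 r μ) :
    Tendsto (fun n => truncLp (hE n) f) atTop (𝓝 f) := by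
  rw [Lp.tendsto_Lp_iff_tendsto_eLpNorm']
  have hae : ∀ n, (truncLp (hE n) f - f : X → 𝕜) =ᵐ[μ] fun x => (E n).indicator f x - f x := by
    intro n
    filter_upwards [coeFn_truncLp (hE n) f] with x hx
    simp [hx]
  refine tendsto_eLpNorm_zero_of_dominated one_le_ne_zero hr
    (fun n => ((Lp.aestronglyMeasurable _).sub (Lp.aestronglyMeasurable _))) (Lp.memLp f)
    (fun n => ?_) ?_
  · filter_upwards [hae n] with x hx
    rw [hx]
    by_cases h : x ∈ E n <;> simp [h]
  · filter_upwards [ae_all_iff.2 hae] with x hx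
    refine tendsto_const_nhds.congr' ?_
    filter_upwards [hlim x] with n hn
    rw [hx n, indicator_of_mem hn, sub_self]

/-- Fatou along an almost everywhere convergent subsequence. The exponent `q` is unrelated to `r`:
this is how bounds in other Lebesgue norms survive limits in `L^r`. -/
theorem eLpNorm_le_of_tendsto_Lp {h : ℕ → Lp 𝕜 r μ} {h' : Lp 𝕜 r μ}
    (hh : Tendsto h atTop (𝓝 h')) {ν : Measure X} (hν : ν ≪ μ) {q K : ℝ≥0∞}
    (hK : ∀ n, eLpNorm (h n) q ν ≤ K) : eLpNorm h' q ν ≤ K := by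
  obtain ⟨φ, -, hφ⟩ := (tendstoInMeasure_of_tendsto_Lp hh).exists_seq_tendsto_ae
  refine (Lp.eLpNorm_lim_le_liminf_eLpNorm
    (fun n => (Lp.aestronglyMeasurable (h (φ n))).mono_ac hν) _ (hν.ae_le hφ)).trans ?_
  refine liminf_le_of_frequently_le' (Frequently.of_forall fun n => hK (φ n))

theorem exists_simpleFunc_tendsto_le (hr : r ≠ ∞) (f : Lp 𝕜 r μ) :
    ∃ g : ℕ → Lp.simpleFunc 𝕜 r μ, Tendsto (fun n => (g n : Lp 𝕜 r μ)) atTop (𝓝 f) ∧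
      ∀ n, ∀ᵐ x ∂μ, ‖(g n : Lp 𝕜 r μ) x‖ ≤ 2 * ‖f x‖ := by
  have hm : Measurable f := (Lp.stronglyMeasurable f).measurable
  have hL : ∀ n, MemLp (SimpleFunc.approxOn f hm univ 0 (mem_univ _) n) r μ :=
    fun n => SimpleFunc.memLp_approxOn hm (Lp.memLp f) _ MemLp.zero n
  refine ⟨fun n => SimpleFunc.toLp _ (hL n), ?_, fun n => ?_⟩
  · rw [Lp.tendsto_Lp_iff_tendsto_eLpNorm']
    have := SimpleFunc.tendsto_approxOn_Lp_eLpNorm hm (mem_univ (0 : 𝕜)) hr (μ := μ)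
      (by simp) (by simpa using Lp.eLpNorm_lt_top f)
    refine this.congr fun n => eLpNorm_congr_ae ?_
    filter_upwards [MemLp.coeFn_toLp (hL n)] with x hx
    rw [Pi.sub_apply, Pi.sub_apply, hx]
  · filter_upwards [MemLp.coeFn_toLp (hL n)] with x hx
    rw [hx, two_mul]
    exact SimpleFunc.norm_approxOn_zero_le hm (mem_univ _) x n

theorem memLp_simpleFunc (hr : r ≠ ∞) (g : Lp.simpleFunc 𝕜 r μ) {s : ℝ≥0∞} :
    MemLp (g : Lp 𝕜 r μ) s μ := by
  have h := (SimpleFunc.memLp_iff_finMeasSupp one_le_ne_zero hr).1 (Lp.simpleFunc.memLp g)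
  have : MemLp (Lp.simpleFunc.toSimpleFunc g) s μ :=
    SimpleFunc.memLp_of_finite_measure_preimage s fun y hy =>
      (SimpleFunc.finMeasSupp_iff.1 h) y hy
  exact this.ae_eq (Lp.simpleFunc.toSimpleFunc_eq_toFun g)

end LpTools

/-! ### Passing estimates from `T` to its extension on `L^r` -/

section Transfer

variable {X : Type*} [MeasurableSpace X] {𝕜 : Type*} [RCLike 𝕜] {μ : Measure X}
  {B : Type*} [NormedAddCommGroup B] [NormedSpace 𝕜 B] {r : ℝ≥0∞} [Fact (1 ≤ r)]

theorem exists_toFun_eq_simpleFunc (ι : FunctionSpace 𝕜 μ B) (hr : r ≠ ∞)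
    (g : Lp.simpleFunc 𝕜 r μ) : ∃ b : B, ι.toFun b = (g : X →ₘ[μ] 𝕜) := by
  refine Lp.simpleFunc.induction (P := fun g => ∃ b : B, ι.toFun b = (g : X →ₘ[μ] 𝕜))
    one_le_ne_zero hr ?_ ?_ g
  · intro c s hs hμs
    obtain ⟨b, hb⟩ := ι.exists_simple s hs hμs
    refine ⟨c • b, ?_⟩
    apply AEEqFun.ext
    rw [map_smul, Lp.simpleFunc.coe_indicatorConst]
    filter_upwards [AEEqFun.coeFn_smul c (ι.toFun b), hb,
      indicatorConstLp_coeFn (p := r) (hs := hs) (hμs := hμs.ne) (c := c)] with x h1 h2 h3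
    rw [h1, Pi.smul_apply, h2]
    refine Eq.trans ?_ h3.symm
    by_cases hx : x ∈ s <;> simp [hx]
  · rintro f g hf hg - ⟨b, hb⟩ ⟨b', hb'⟩
    exact ⟨b + b', by rw [map_add, hb, hb']; rfl⟩

/-- Simple functions tending to `f` in `L^r` and dominated by `2 * ‖f‖` come from the core; the
domination accounts for the factor `2`. Since `ν` and `ν'` have mass at most one, Hölder permits
raising `p` to `p₁` and lowering `q` to `q₁`. -/
theorem eLpNorm_extension_le {ι : FunctionSpace 𝕜 μ B} {T : ℝ → B →L[𝕜] B} (hr : r ≠ ∞)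
    {S : ℝ → Lp 𝕜 r μ →L[𝕜] Lp 𝕜 r μ} (hS : IsLpExtension ι T r S) {t : ℝ} (ht : 0 < t)
    {E : Set X} {p p₁ q q₁ : ℝ≥0∞} (hp : 1 ≤ p) (hpp : p ≤ p₁) (hq : 1 ≤ q₁) (hqq : q₁ ≤ q)
    {ν ν' : Measure X} (hν : ν ≪ μ) (hν' : ν' ≪ μ) (hν1 : ν univ ≤ 1) (hν1' : ν' univ ≤ 1)
    {K : ℝ≥0∞}
    (h : ∀ b : B, MemLp (ι.toFun b) p μ → (∀ᵐ x ∂μ, x ∉ E → ι.toFun b x = 0) →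
      eLpNorm (ι.toFun (T t b)) q ν ≤ K * eLpNorm (ι.toFun b) p ν')
    (f : Lp 𝕜 r μ) (hf : ∀ᵐ x ∂μ, x ∉ E → f x = 0) :
    eLpNorm (S t f) q₁ ν ≤ 2 * K * eLpNorm f p₁ ν' := by
  obtain ⟨g, hg, hgf⟩ := exists_simpleFunc_tendsto_le hr f
  refine eLpNorm_le_of_tendsto_Lp (((S t).continuous.tendsto f).comp hg) hν fun n => ?_
  obtain ⟨b, hb⟩ := exists_toFun_eq_simpleFunc ι hr (g n)
  have hcore : b ∈ core ι := fun s _ => by rw [hb]; exact memLp_simpleFunc hr (g n)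
  have hext := hS t ht b hcore (g n) hb.symm
  -- The pointwise domination makes the approximants vanish wherever `f` does.
  have h0 : ∀ᵐ x ∂μ, x ∉ E → ι.toFun b x = 0 := by
    filter_upwards [hf, hgf n] with x hx hx' hxE
    rw [hx hxE, norm_zero, mul_zero] at hx'
    rw [hb]
    exact norm_le_zero_iff.1 hx'
  have h1 := h b (hcore p hp) h0
  have h2 : eLpNorm (ι.toFun b) p ν' ≤ 2 * eLpNorm f p₁ ν' := by
    rw [hb]
    refine (eLpNorm_le_of_measure_univ_le_one hp hpp hν1'
      ((Lp.aestronglyMeasurable _).mono_ac hν')).trans ?_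
    have := eLpNorm_le_mul_eLpNorm_of_ae_le_mul (hν'.ae_le (hgf n)) p₁
    simpa using this
  calc eLpNorm (S t (g n)) q₁ ν ≤ eLpNorm (S t (g n)) q ν :=
        eLpNorm_le_of_measure_univ_le_one hq hqq hν1 ((Lp.aestronglyMeasurable _).mono_ac hν)
    _ ≤ K * eLpNorm (ι.toFun b) p ν' := by rw [hext]; exact h1
    _ ≤ K * (2 * eLpNorm f p₁ ν') := by gcongr
    _ = 2 * K * eLpNorm f p₁ ν' := by ring

end Transfer

/-! ### Gaussian factors reduced to polynomial decay -/

section Coefficients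

theorem exists_pow_mul_ups_rpow_mul_exp_le {θ c : ℝ} (hc : 0 < c) {m : ℕ}
    (hm : θ ≤ m) : ∃ C : ℝ, 0 < C ∧
      ∀ s : ℝ, 0 < s → s ^ m * (ups s ^ θ * Real.exp (-(c * s ^ 2))) ≤ C := by
  refine ⟨1 + m.factorial / c ^ m, by positivity, fun s hs => ?_⟩
  rcases le_total s 1 with h | h
  · have hu : ups s = s⁻¹ := max_eq_right (h.trans ((one_le_inv₀ hs).2 h))
    have h1 : Real.exp (-(c * s ^ 2)) ≤ 1 := Real.exp_le_one_iff.2 (by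
      rw [neg_nonpos]; positivity)
    have h2 : s ^ m * (ups s) ^ θ ≤ 1 := by
      rw [hu, Real.inv_rpow hs.le, ← div_eq_mul_inv, div_le_one (by positivity),
        ← Real.rpow_natCast]
      exact Real.rpow_le_rpow_of_exponent_ge hs h hm
    have h3 : 0 ≤ (m.factorial : ℝ) / c ^ m := by positivity
    calc s ^ m * (ups s ^ θ * Real.exp (-(c * s ^ 2)))
        = (s ^ m * ups s ^ θ) * Real.exp (-(c * s ^ 2)) := by ring
      _ ≤ 1 * 1 := by gcongr
      _ ≤ _ := by linarith
  · have hu : ups s = s := max_eq_left ((inv_le_one_of_one_le₀ h).trans h)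
    have h1 : s ^ θ ≤ s ^ m := by
      rw [← Real.rpow_natCast]
      exact Real.rpow_le_rpow_of_exponent_le h hm
    have h2 : (c * s ^ 2) ^ m / m.factorial ≤ Real.exp (c * s ^ 2) :=
      Real.pow_div_factorial_le_exp _ (by positivity) m
    have h4 : (s ^ 2) ^ m * Real.exp (-(c * s ^ 2)) ≤ m.factorial / c ^ m := by
      rw [Real.exp_neg, ← div_eq_mul_inv, div_le_div_iff₀ (Real.exp_pos _) (by positivity)]
      rw [div_le_iff₀ (by positivity), mul_pow] at h2
      linarith
    rw [hu]
    calc s ^ m * (s ^ θ * Real.exp (-(c * s ^ 2)))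
        ≤ s ^ m * (s ^ m * Real.exp (-(c * s ^ 2))) := by gcongr
      _ = (s ^ 2) ^ m * Real.exp (-(c * s ^ 2)) := by ring
      _ ≤ _ := by linarith

/-- The Gaussian in `s = 2^j ρ / √t` absorbs any power of `s`. The surplus pays for `2^(j θ₁)`, for
the factor `ups`, and for any prescribed decay `2^(-j n)`; a positive power of `√t` remains and
vanishes as `t → 0`. -/
theorem exists_coefficient_le {θ₁ θ₂ c C : ℝ} (hc : 0 < c)
    (hC : 0 < C) (n : ℕ) : ∃ m : ℕ, 0 < m ∧ ∃ C' : ℝ≥0, ∀ t : ℝ, 0 < t → ∀ ρ : ℝ, 0 < ρ → ∀ j : ℕ,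
      C * (2 : ℝ) ^ (j * θ₁) * ups (2 ^ j * ρ / √t) ^ θ₂ * Real.exp (-(c * 4 ^ j * ρ ^ 2 / t)) ≤
        C' * (((2 : ℝ) ^ j)⁻¹ ^ n * (√t / ρ) ^ m) := by
  obtain ⟨k, hk⟩ := exists_nat_ge θ₁
  obtain ⟨l, hl⟩ := exists_nat_ge θ₂
  obtain ⟨C₁, hC₁, h⟩ := exists_pow_mul_ups_rpow_mul_exp_le (θ := θ₂) hc (m := n + k + l + 1)
    (by push_cast; linarith [Nat.cast_nonneg (α := ℝ) n, Nat.cast_nonneg (α := ℝ) k])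
  -- In the exponent, `n` is the wanted decay, `k` compensates `θ₁`, `l` dominates `θ₂`, and `1`
  -- ensures positivity.
  refine ⟨n + k + l + 1, by omega, ⟨C * C₁, by positivity⟩, fun t ht ρ hρ j => ?_⟩
  have hst : 0 < √t := Real.sqrt_pos.2 ht
  set s : ℝ := 2 ^ j * ρ / √t with hs
  have hs0 : 0 < s := by positivity
  have hexp : c * 4 ^ j * ρ ^ 2 / t = c * s ^ 2 := by
    rw [hs, div_pow, mul_pow, Real.sq_sqrt ht.le, ← pow_mul, mul_comm j 2, pow_mul]
    norm_num
    ring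
  have h1 : (2 : ℝ) ^ (j * θ₁) ≤ (2 ^ j) ^ k := by
    rw [← pow_mul, ← Real.rpow_natCast, Nat.cast_mul]
    exact Real.rpow_le_rpow_of_exponent_le (by norm_num) (by gcongr)
  have h2 : ups s ^ θ₂ * Real.exp (-(c * s ^ 2)) ≤ C₁ * (s⁻¹) ^ (n + k + l + 1) := by
    rw [inv_pow, ← div_eq_mul_inv, le_div_iff₀ (by positivity), mul_comm]
    exact h s hs0
  have hsi : s⁻¹ = (2 ^ j)⁻¹ * (√t / ρ) := by rw [hs]; field_simp
  have h3 : ((2 : ℝ) ^ j) ^ k * ((2 ^ j)⁻¹) ^ (n + k + l + 1) ≤ ((2 ^ j)⁻¹) ^ n := by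
    have h5 : ((2 : ℝ) ^ j) ^ k * ((2 ^ j)⁻¹) ^ k = 1 := by
      rw [← mul_pow, mul_inv_cancel₀ (by positivity), one_pow]
    have h6 : ((2 : ℝ) ^ j)⁻¹ ^ (l + 1) ≤ 1 :=
      pow_le_one₀ (by positivity) (inv_le_one_of_one_le₀ (one_le_pow₀ (by norm_num)))
    calc ((2 : ℝ) ^ j) ^ k * ((2 ^ j)⁻¹) ^ (n + k + l + 1)
        = (((2 : ℝ) ^ j) ^ k * ((2 ^ j)⁻¹) ^ k) * ((2 ^ j)⁻¹ ^ n * (2 ^ j)⁻¹ ^ (l + 1)) := by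
          ring
      _ ≤ 1 * ((2 ^ j)⁻¹ ^ n * 1) := by rw [h5]; gcongr
      _ = _ := by ring
  rw [hexp]
  calc C * (2 : ℝ) ^ (j * θ₁) * ups s ^ θ₂ * Real.exp (-(c * s ^ 2))
      = C * (2 : ℝ) ^ (j * θ₁) * (ups s ^ θ₂ * Real.exp (-(c * s ^ 2))) := by ring
    _ ≤ C * (2 ^ j) ^ k * (C₁ * (s⁻¹) ^ (n + k + l + 1)) := by
        have : 0 ≤ ups s := hs0.le.trans (le_max_left _ _)
        gcongr
    _ = C * C₁ * (((2 ^ j) ^ k * ((2 ^ j)⁻¹) ^ (n + k + l + 1)) * (√t / ρ) ^ (n + k + l + 1)) := by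
        rw [hsi, mul_pow]; ring
    _ ≤ C * C₁ * (((2 : ℝ) ^ j)⁻¹ ^ n * (√t / ρ) ^ (n + k + l + 1)) := by gcongr
    _ = _ := rfl

end Coefficients

/-! ### Off-diagonal estimates for operators on `L^r` -/

section OffDiagonalLp

variable {X : Type*} [MetricSpace X] [MeasurableSpace X]
  {𝕜 : Type*} [RCLike 𝕜] {μ : Measure X}
  {r : ℝ≥0∞}

/-- Off-diagonal estimates for operators on `L^r`, with the constants in the polynomial form in
which they are used. -/
def OffDiagonalLp [Fact (1 ≤ r)] (U : ℝ → Lp 𝕜 r μ →L[𝕜] Lp 𝕜 r μ) (p q : ℝ≥0∞) : Prop :=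
  (∃ D : ℝ → ℝ≥0, ∀ t : ℝ, 0 < t → ∀ (x : X) (ρ : ℝ), 0 < ρ → ∀ f : Lp 𝕜 r μ,
    (∀ᵐ y ∂μ, y ∉ Metric.ball x ρ → f y = 0) →
      avgNorm μ q (Metric.ball x ρ) (Metric.ball x ρ) (U t f) ≤
        D (ρ / √t) * avgNorm μ p (Metric.ball x ρ) (Metric.ball x ρ) f) ∧
  ∀ n : ℕ, ∃ m : ℕ, 0 < m ∧ ∃ C : ℝ≥0, ∀ t : ℝ, 0 < t → ∀ (x : X) (ρ : ℝ), 0 < ρ → ∀ j : ℕ, 2 ≤ j →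
    ∀ f : Lp 𝕜 r μ,
    ((∀ᵐ y ∂μ, y ∉ annulus x ρ j → f y = 0) →
      avgNorm μ q (Metric.ball x ρ) (Metric.ball x ρ) (U t f) ≤
        C * ENNReal.ofReal (((2 : ℝ) ^ j)⁻¹ ^ n * (√t / ρ) ^ m) *
          avgNorm μ p (Metric.ball x (2 ^ (j + 1) * ρ)) (annulus x ρ j) f) ∧
    ((∀ᵐ y ∂μ, y ∉ Metric.ball x ρ → f y = 0) →
      avgNorm μ q (Metric.ball x (2 ^ (j + 1) * ρ)) (annulus x ρ j) (U t f) ≤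
        C * ENNReal.ofReal (((2 : ℝ) ^ j)⁻¹ ^ n * (√t / ρ) ^ m) *
          avgNorm μ p (Metric.ball x ρ) (Metric.ball x ρ) f)

omit [MetricSpace X] in
theorem inv_smul_restrict_ac (F E : Set X) : (μ F)⁻¹ • μ.restrict E ≪ μ :=
  Measure.smul_absolutelyContinuous.trans Measure.restrict_le_self.absolutelyContinuous

omit [MetricSpace X] in
theorem inv_smul_restrict_univ_le {F E : Set X} (h : E ⊆ F) :
    ((μ F)⁻¹ • μ.restrict E) univ ≤ 1 := by
  rw [Measure.smul_apply, Measure.restrict_apply_univ, smul_eq_mul]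
  exact (mul_le_mul_right (measure_mono h) _).trans (ENNReal.inv_mul_le_one _)

theorem trunc_eq_self [BorelSpace X] {B : Type*} [NormedAddCommGroup B] [NormedSpace 𝕜 B]
    (ι : FunctionSpace 𝕜 μ B) {E : Set X} (hE : MeasurableSet E) {b : B}
    (hb : ∀ᵐ x ∂μ, x ∉ E → ι.toFun b x = 0) : ι.trunc hE b = b := by
  apply ι.injective
  apply AEEqFun.ext
  filter_upwards [ι.trunc_spec hE b, hb] with x h1 h2
  rw [h1]
  by_cases hx : x ∈ E
  · rw [indicator_of_mem hx]
  · rw [indicator_of_notMem hx, h2 hx]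

theorem OffDiagonal.offDiagonalLp [BorelSpace X] [Fact (1 ≤ r)]
    {B : Type*} [NormedAddCommGroup B] [NormedSpace 𝕜 B]
    {ι : FunctionSpace 𝕜 μ B} {T : ℝ → B →L[𝕜] B} {p q p₁ q₁ : ℝ≥0∞}
    (h : OffDiagonal ι T p q) (hr : r ≠ ∞) {S : ℝ → Lp 𝕜 r μ →L[𝕜] Lp 𝕜 r μ}
    (hS : IsLpExtension ι T r S) (hp : 1 ≤ p) (hpp : p ≤ p₁) (hq : 1 ≤ q₁) (hqq : q₁ ≤ q) :
    OffDiagonalLp S p₁ q₁ := by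
  obtain ⟨θ₁, θ₂, c, C, -, -, hc, hC, h⟩ := h
  refine ⟨⟨fun s => 2 * (C * ups s ^ θ₂).toNNReal, fun t ht x ρ hρ f hf => ?_⟩, fun n => ?_⟩
  · have := eLpNorm_extension_le hr hS ht hp hpp hq hqq
      (inv_smul_restrict_ac (μ := μ) (Metric.ball x ρ) (Metric.ball x ρ))
      (inv_smul_restrict_ac (μ := μ) (Metric.ball x ρ) (Metric.ball x ρ))
      (inv_smul_restrict_univ_le le_rfl) (inv_smul_restrict_univ_le le_rfl)
      (K := ENNReal.ofReal (C * ups (ρ / √t) ^ θ₂)) (E := Metric.ball x ρ)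
      (fun b hb hb0 => by
        have h1 := (h t ht x ρ hρ b hb).1
        rwa [trunc_eq_self ι _ hb0] at h1) f hf
    simpa [avgNorm, ENNReal.ofReal] using this
  · obtain ⟨m, hm, C', hC'⟩ := exists_coefficient_le (θ₁ := θ₁) hc hC n
    refine ⟨m, hm, 2 * C', fun t ht x ρ hρ j hj f => ⟨fun hf => ?_, fun hf => ?_⟩⟩
    all_goals
      have hcoef : 2 * ENNReal.ofReal (C * (2 : ℝ) ^ (j * θ₁) * ups (2 ^ j * ρ / √t) ^ θ₂ *
          Real.exp (-(c * 4 ^ j * ρ ^ 2 / t))) ≤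
          ((2 * C' : ℝ≥0) : ℝ≥0∞) * ENNReal.ofReal (((2 : ℝ) ^ j)⁻¹ ^ n * (√t / ρ) ^ m) := by
        refine (mul_le_mul_right (ENNReal.ofReal_le_ofReal (hC' t ht ρ hρ j)) _).trans_eq ?_
        rw [ENNReal.ofReal_mul (NNReal.coe_nonneg _), ENNReal.ofReal_coe_nnreal]
        push_cast
        ring
    · refine le_trans ?_ (mul_le_mul_left hcoef _)
      exact eLpNorm_extension_le hr hS ht hp hpp hq hqq
        (inv_smul_restrict_ac _ _) (inv_smul_restrict_ac _ _)
        (inv_smul_restrict_univ_le le_rfl) (inv_smul_restrict_univ_le sdiff_subset)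
        (fun b hb hb0 => by
          have h1 := ((h t ht x ρ hρ b hb).2 j hj).1
          rwa [trunc_eq_self ι _ hb0] at h1) f hf
    · refine le_trans ?_ (mul_le_mul_left hcoef _)
      exact eLpNorm_extension_le hr hS ht hp hpp hq hqq
        (inv_smul_restrict_ac _ _) (inv_smul_restrict_ac _ _)
        (inv_smul_restrict_univ_le sdiff_subset) (inv_smul_restrict_univ_le le_rfl)
        (fun b hb hb0 => by
          have h1 := ((h t ht x ρ hρ b hb).2 j hj).2
          rwa [trunc_eq_self ι _ hb0] at h1) f hf

end OffDiagonalLp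

/-! ### Doubling measures and nets -/

section Doubling

variable {X : Type*} [MetricSpace X] [MeasurableSpace X] {μ : Measure X} {C₀ : ℝ≥0}

theorem measure_ball_two_pow_le
    (hd : ∀ (x : X) (r : ℝ), 0 < r →
      μ (Metric.ball x (2 * r)) ≤ C₀ * μ (Metric.ball x r) ∧ μ (Metric.ball x r) < ∞)
    (x : X) {r : ℝ} (hr : 0 < r) (k : ℕ) :
    μ (Metric.ball x (2 ^ k * r)) ≤ C₀ ^ k * μ (Metric.ball x r) := by
  induction k with
  | zero => simp
  | succ k ih =>
    calc μ (Metric.ball x (2 ^ (k + 1) * r)) = μ (Metric.ball x (2 * (2 ^ k * r))) := by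
          congr 2; ring
      _ ≤ C₀ * μ (Metric.ball x (2 ^ k * r)) := (hd x _ (by positivity)).1
      _ ≤ C₀ * (C₀ ^ k * μ (Metric.ball x r)) := by gcongr
      _ = _ := by ring

theorem measure_ball_pos_of_doubling
    (hd : ∀ (x : X) (r : ℝ), 0 < r →
      μ (Metric.ball x (2 * r)) ≤ C₀ * μ (Metric.ball x r) ∧ μ (Metric.ball x r) < ∞)
    (hμ : μ ≠ 0) (x : X) {r : ℝ} (hr : 0 < r) : 0 < μ (Metric.ball x r) := by
  refine pos_iff_ne_zero.2 fun h => hμ ?_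
  have h1 : ∀ k : ℕ, μ (Metric.ball x (2 ^ k * r)) = 0 := fun k => by
    have := measure_ball_two_pow_le hd x hr k
    rwa [h, mul_zero, nonpos_iff_eq_zero] at this
  rw [← Measure.measure_univ_eq_zero, ← nonpos_iff_eq_zero]
  have h2 : (univ : Set X) ⊆ ⋃ k : ℕ, Metric.ball x (2 ^ k * r) := fun y _ => by
    obtain ⟨k, hk⟩ := pow_unbounded_of_one_lt (dist y x / r) (one_lt_two (α := ℝ))
    exact mem_iUnion.2 ⟨k, Metric.mem_ball.2 ((div_lt_iff₀ hr).1 hk)⟩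
  exact (measure_mono h2).trans (measure_iUnion_null h1).le

theorem sigmaFinite_of_doubling [Nonempty X]
    (hd : ∀ (x : X) (r : ℝ), 0 < r →
      μ (Metric.ball x (2 * r)) ≤ C₀ * μ (Metric.ball x r) ∧ μ (Metric.ball x r) < ∞) :
    SigmaFinite μ := by
  let x₀ : X := Classical.arbitrary X
  refine ⟨⟨⟨fun n => Metric.ball x₀ (n + 1), fun _ => trivial,
    fun n => (hd x₀ _ (by positivity)).2, ?_⟩⟩⟩
  refine eq_univ_of_forall fun y => ?_
  obtain ⟨n, hn⟩ := exists_nat_gt (dist y x₀)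
  exact mem_iUnion.2 ⟨n, Metric.mem_ball.2 (hn.trans (by linarith))⟩

/-- A countable net of mesh `ρ`, with a bound for the overlap of enlarged balls weighted by the
relative volume. -/
theorem exists_countable_net [Nonempty X] [BorelSpace X]
    (hd : ∀ (x : X) (r : ℝ), 0 < r →
      μ (Metric.ball x (2 * r)) ≤ C₀ * μ (Metric.ball x r) ∧ μ (Metric.ball x r) < ∞)
    (hμ : μ ≠ 0) {ρ : ℝ} (hρ : 0 < ρ) :
    ∃ s : Set X, s.Countable ∧ (⋃ x : s, Metric.ball (x : X) ρ) = univ ∧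
      ∀ R : ℝ, ρ ≤ R → ∀ y : X,
        ∑' x : s, (Metric.ball (x : X) R).indicator
          (fun _ => μ (Metric.ball (x : X) ρ) * (μ (Metric.ball (x : X) R))⁻¹) y ≤ C₀ ^ 5 := by
  -- The disjoint balls have radius `ρ / 8`, and their fourfold enlargements, of radius `ρ / 2 < ρ`,
  -- cover.
  obtain ⟨s, -, hdisj, hcov⟩ := Vitali.exists_disjoint_subfamily_covering_enlargement_closedBall
    (univ : Set X) id (fun _ => ρ / 8) (ρ / 8) (fun _ _ => le_rfl) 4 (by norm_num)
  simp only [id] at hdisj hcov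
  have := sigmaFinite_of_doubling hd
  have hdisj' : Pairwise (Function.onFun Disjoint fun x : s => Metric.closedBall (x : X) (ρ / 8)) :=
    fun a b hab => hdisj a.2 b.2 (fun h => hab (Subtype.ext h))
  have hcount : s.Countable := by
    have h1 := Measure.countable_meas_pos_of_disjoint_iUnion (μ := μ)
      (As := fun x : s => Metric.closedBall (x : X) (ρ / 8))
      (fun _ => Metric.isClosed_closedBall.measurableSet) hdisj'
    have h2 : {x : s | 0 < μ (Metric.closedBall (x : X) (ρ / 8))} = univ :=
      eq_univ_of_forall fun x => (measure_ball_pos_of_doubling hd hμ (x : X)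
        (by positivity : 0 < ρ / 8)).trans_le (measure_mono Metric.ball_subset_closedBall)
    rw [h2] at h1
    exact countable_coe_iff.1 (countable_univ_iff.1 h1)
  have := hcount.to_subtype
  refine ⟨s, hcount, eq_univ_of_forall fun y => ?_, fun R hR y => ?_⟩
  · obtain ⟨b, hb, hyb⟩ := hcov y (mem_univ _)
    have := hyb (Metric.mem_closedBall_self (by positivity))
    refine mem_iUnion.2 ⟨⟨b, hb⟩, Metric.mem_ball.2 ((Metric.mem_closedBall.1 this).trans_lt ?_)⟩
    linarith
  · have hR0 : 0 < R := hρ.trans_le hR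
    have hV0 : μ (Metric.ball y (2 * R)) ≠ 0 :=
      (measure_ball_pos_of_doubling hd hμ y (by positivity)).ne'
    have hV : μ (Metric.ball y (2 * R)) ≠ ∞ := (hd y _ (by positivity)).2.ne
    -- Each term is compared with the share of `B(y, 2R)` filled by the disjoint ball of radius `ρ /
    -- 8`. Three doublings pass from `ρ / 8` to `ρ`, and two from `B(x, R)` to `B(x, 4R) ⊇ B(y,
    -- 2R)`, whence the exponent `5`.
    have hterm : ∀ x : s, (Metric.ball (x : X) R).indicator
        (fun _ => μ (Metric.ball (x : X) ρ) * (μ (Metric.ball (x : X) R))⁻¹) y ≤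
        C₀ ^ 5 * (μ (Metric.ball y (2 * R)))⁻¹ *
          μ (Metric.closedBall (x : X) (ρ / 8) ∩ Metric.ball y (2 * R)) := by
      intro x
      by_cases hy : y ∈ Metric.ball (x : X) R
      swap
      · rw [indicator_of_notMem hy]; exact zero_le
      rw [indicator_of_mem hy]
      have hy' : dist y (x : X) < R := hy
      have e1 : Metric.closedBall (x : X) (ρ / 8) ∩ Metric.ball y (2 * R) =
          Metric.closedBall (x : X) (ρ / 8) := by
        refine inter_eq_left.2 fun z hz => ?_
        have hz' : dist z (x : X) ≤ ρ / 8 := hz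
        have := dist_triangle_right z y (x : X)
        rw [Metric.mem_ball]
        linarith
      have e2 : μ (Metric.ball (x : X) ρ) ≤ C₀ ^ 3 * μ (Metric.closedBall (x : X) (ρ / 8)) := by
        have := measure_ball_two_pow_le hd (x : X) (by positivity : 0 < ρ / 8) 3
        rw [show (2 : ℝ) ^ 3 * (ρ / 8) = ρ by ring] at this
        exact this.trans (by gcongr; exact Metric.ball_subset_closedBall)
      have e3 : μ (Metric.ball y (2 * R)) ≤ C₀ ^ 2 * μ (Metric.ball (x : X) R) := by
        refine le_trans (measure_mono fun z hz => ?_) (measure_ball_two_pow_le hd (x : X) hR0 2)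
        have hz' : dist z y < 2 * R := hz
        have := dist_triangle z y (x : X)
        rw [Metric.mem_ball]
        linarith
      have hW0 : μ (Metric.ball (x : X) R) ≠ 0 :=
        (measure_ball_pos_of_doubling hd hμ (x : X) hR0).ne'
      have hW : μ (Metric.ball (x : X) R) ≠ ∞ := (hd (x : X) R hR0).2.ne
      have e4 : (μ (Metric.ball (x : X) R))⁻¹ ≤ C₀ ^ 2 * (μ (Metric.ball y (2 * R)))⁻¹ := by
        rw [← div_eq_mul_inv, ENNReal.le_div_iff_mul_le (Or.inl hV0) (Or.inl hV), mul_comm,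
          ← div_eq_mul_inv]
        exact ENNReal.div_le_of_le_mul e3
      rw [e1]
      calc μ (Metric.ball (x : X) ρ) * (μ (Metric.ball (x : X) R))⁻¹
          ≤ (C₀ ^ 3 * μ (Metric.closedBall (x : X) (ρ / 8))) *
            (C₀ ^ 2 * (μ (Metric.ball y (2 * R)))⁻¹) := mul_le_mul' e2 e4
        _ = _ := by ring
    refine (ENNReal.tsum_le_tsum hterm).trans ?_
    rw [ENNReal.tsum_mul_left, ← measure_iUnion
      (fun a b hab => (hdisj' hab).mono inter_subset_left inter_subset_left)
      (fun _ => Metric.isClosed_closedBall.measurableSet.inter measurableSet_ball)]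
    calc _ ≤ C₀ ^ 5 * (μ (Metric.ball y (2 * R)))⁻¹ * μ (Metric.ball y (2 * R)) := by
          gcongr
          exact iUnion_subset fun _ => inter_subset_right
      _ = C₀ ^ 5 := by rw [mul_assoc, ENNReal.inv_mul_cancel hV0 hV, mul_one]

end Doubling

/-! ### Averaged norms against restricted norms -/

section Averages

variable {X : Type*} [MeasurableSpace X] {𝕜 : Type*} [RCLike 𝕜] {μ : Measure X}

theorem avgNorm_eq (q : ℝ≥0∞) {F : Set X} (hF : μ F ≠ ∞) (E : Set X) (h : X → 𝕜) :
    avgNorm μ q F E h = (μ F)⁻¹ ^ (1 / q).toReal * eLpNorm h q (μ.restrict E) := by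
  rw [avgNorm, eLpNorm_smul_measure_of_ne_zero (ENNReal.inv_ne_zero.2 hF), smul_eq_mul]

theorem eLpNorm_restrict_eq_avgNorm (q : ℝ≥0∞) {F : Set X} (hF0 : μ F ≠ 0) (hF : μ F ≠ ∞)
    (E : Set X) (h : X → 𝕜) :
    eLpNorm h q (μ.restrict E) = μ F ^ (1 / q).toReal * avgNorm μ q F E h := by
  rw [avgNorm_eq q hF, ← mul_assoc, ← ENNReal.mul_rpow_of_nonneg _ _ ENNReal.toReal_nonneg,
    ENNReal.mul_inv_cancel hF0 hF, ENNReal.one_rpow, one_mul]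

theorem avgNorm_mono {q : ℝ≥0∞} {F E E' : Set X} (hE : E ⊆ E') (h : X → 𝕜) :
    avgNorm μ q F E h ≤ avgNorm μ q F E' h := by
  refine eLpNorm_mono_measure _ ?_
  gcongr

end Averages

/-! ### Uniform boundedness on `L^p` -/

section UniformBound

variable {X : Type*} [MetricSpace X] [MeasurableSpace X] [BorelSpace X]
  {𝕜 : Type*} [RCLike 𝕜] {μ : Measure X} {C₀ : ℝ≥0} {r : ℝ≥0∞} [Fact (1 ≤ r)]
  {U : ℝ → Lp 𝕜 r μ →L[𝕜] Lp 𝕜 r μ} {p : ℝ≥0∞}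

omit [MeasurableSpace X] [BorelSpace X] in
theorem disjoint_ball_annulus (x : X) (ρ : ℝ) (j : ℕ) :
    Disjoint (Metric.ball x (2 ^ j * ρ)) (annulus x ρ j) :=
  disjoint_sdiff_right

omit [MeasurableSpace X] [BorelSpace X] in
theorem ball_union_annulus (x : X) {ρ : ℝ} (hρ : 0 < ρ) (j : ℕ) :
    Metric.ball x (2 ^ j * ρ) ∪ annulus x ρ j = Metric.ball x (2 ^ (j + 1) * ρ) := by
  refine union_sdiff_cancel (Metric.ball_subset_ball ?_)
  gcongr
  · norm_num
  · omega

/-- At the scale `√t` of the ball the coefficients no longer depend on `t`. The ball of radius `4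
√t` uses the on-diagonal estimate, and each further annulus contributes a geometrically small term.
Truncations keep the sums finite, before a limit in `L^r`. -/
theorem OffDiagonalLp.exists_eLpNorm_truncLp_le
    (hd : ∀ (x : X) (r : ℝ), 0 < r →
      μ (Metric.ball x (2 * r)) ≤ C₀ * μ (Metric.ball x r) ∧ μ (Metric.ball x r) < ∞)
    (hμ : μ ≠ 0) (hp : 1 ≤ p) (hU : OffDiagonalLp U p p) :
    ∃ C : ℝ≥0, ∀ t : ℝ, 0 < t → ∀ (x : X) (f : Lp 𝕜 r μ) (n : ℕ),
      eLpNorm (U t (truncLp (measurableSet_ball (x := x) (ε := 2 ^ (n + 2) * √t)) f)) p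
          (μ.restrict (Metric.ball x √t)) ≤
        C * μ (Metric.ball x √t) ^ (1 / p).toReal * ∑ i ∈ Finset.range (n + 1),
          (2⁻¹ : ℝ≥0∞) ^ i * avgNorm μ p (Metric.ball x (2 ^ (i + 2) * √t))
            (Metric.ball x (2 ^ (i + 2) * √t)) f := by
  obtain ⟨⟨D, hD⟩, hA⟩ := hU
  obtain ⟨m, -, C₁, hC₁⟩ := hA 1
  set e := (1 / p).toReal
  refine ⟨(C₀ ^ 2) ^ e * D 4 + C₁, fun t ht x f n => ?_⟩
  have hρ : 0 < √t := Real.sqrt_pos.2 ht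
  have hpos : ∀ R, 0 < R → μ (Metric.ball x R) ≠ 0 := fun R hR =>
    (measure_ball_pos_of_doubling hd hμ x hR).ne'
  have hfin : ∀ R, 0 < R → μ (Metric.ball x R) ≠ ∞ := fun R hR => (hd x R hR).2.ne
  induction n with
  | zero =>
    have h4 : 0 < (2 : ℝ) ^ (0 + 2) * √t := by positivity
    have h1 := hD t ht x _ h4 _ (truncLp_eq_zero measurableSet_ball f)
    rw [show (2 : ℝ) ^ (0 + 2) * √t / √t = 4 by field_simp; norm_num] at h1
    have h2 : μ (Metric.ball x (2 ^ (0 + 2) * √t)) ^ e ≤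
        ((C₀ ^ 2) ^ e : ℝ≥0) * μ (Metric.ball x √t) ^ e := by
      rw [ENNReal.coe_rpow_of_nonneg _ ENNReal.toReal_nonneg,
        ← ENNReal.mul_rpow_of_nonneg _ _ ENNReal.toReal_nonneg]
      refine ENNReal.rpow_le_rpow ?_ ENNReal.toReal_nonneg
      simpa using measure_ball_two_pow_le hd x hρ 2
    calc _ ≤ eLpNorm (U t (truncLp (measurableSet_ball (x := x) (ε := 2 ^ (0 + 2) * √t)) f)) p
          (μ.restrict (Metric.ball x (2 ^ (0 + 2) * √t))) := by
          refine eLpNorm_mono_measure _ (Measure.restrict_mono (Metric.ball_subset_ball ?_) le_rfl)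
          norm_num
          linarith
      _ = μ (Metric.ball x (2 ^ (0 + 2) * √t)) ^ e * avgNorm μ p _ _ _ :=
          eLpNorm_restrict_eq_avgNorm p (hpos _ h4) (hfin _ h4) _ _
      _ ≤ (((C₀ ^ 2) ^ e : ℝ≥0) * μ (Metric.ball x √t) ^ e) * (D 4 * avgNorm μ p
            (Metric.ball x (2 ^ (0 + 2) * √t)) (Metric.ball x (2 ^ (0 + 2) * √t)) f) := by
          refine mul_le_mul' h2 (h1.trans (mul_le_mul_right ?_ _))
          exact eLpNorm_truncLp_le _ _ _ (inv_smul_restrict_ac _ _)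
      _ = ((C₀ ^ 2) ^ e * D 4 : ℝ≥0) * μ (Metric.ball x √t) ^ e * avgNorm μ p
            (Metric.ball x (2 ^ (0 + 2) * √t)) (Metric.ball x (2 ^ (0 + 2) * √t)) f := by
          push_cast; ring
      _ ≤ _ := by
          rw [zero_add, Finset.sum_range_one, pow_zero, one_mul]
          gcongr
          exact le_self_add
  | succ n ih =>
    have hsplit : truncLp (measurableSet_ball (x := x) (ε := 2 ^ (n + 1 + 2) * √t)) f =
        truncLp (measurableSet_ball (x := x) (ε := 2 ^ (n + 2) * √t)) f +
          truncLp (measurableSet_annulus x √t (n + 2)) f := by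
      rw [← truncLp_add_truncLp_of_disjoint _ _ (disjoint_ball_annulus x √t (n + 2))]
      simp only [ball_union_annulus x hρ]
    rw [hsplit, map_add, Finset.sum_range_succ, mul_add]
    have hac : μ.restrict (Metric.ball x √t) ≪ μ := Measure.restrict_le_self.absolutelyContinuous
    rw [eLpNorm_congr_ae (hac.ae_le (Lp.coeFn_add _ _))]
    refine (eLpNorm_add_le ((Lp.aestronglyMeasurable _).mono_ac hac)
      ((Lp.aestronglyMeasurable _).mono_ac hac) hp).trans (add_le_add ih ?_)
    have h1 := (hC₁ t ht x _ hρ (n + 2) (by omega) _).1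
      (truncLp_eq_zero (measurableSet_annulus x √t (n + 2)) f)
    rw [eLpNorm_restrict_eq_avgNorm p (hpos _ hρ) (hfin _ hρ)]
    have h2 : ENNReal.ofReal (((2 : ℝ) ^ (n + 2))⁻¹ ^ 1 * (√t / √t) ^ m) ≤
        (2⁻¹ : ℝ≥0∞) ^ (n + 1) := by
      rw [div_self hρ.ne', one_pow, mul_one, pow_one, ENNReal.ofReal_inv_of_pos (by positivity),
        ENNReal.ofReal_pow (by norm_num), ← ENNReal.inv_pow]
      norm_num
      gcongr
      · norm_num
      · omega
    calc _ ≤ μ (Metric.ball x √t) ^ e * (C₁ * (2⁻¹ : ℝ≥0∞) ^ (n + 1) *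
          avgNorm μ p (Metric.ball x (2 ^ (n + 1 + 2) * √t))
            (Metric.ball x (2 ^ (n + 1 + 2) * √t)) f) := by
          refine mul_le_mul_right (h1.trans (mul_le_mul' (mul_le_mul_right h2 _) ?_)) _
          refine (eLpNorm_truncLp_le _ _ _ (inv_smul_restrict_ac _ _)).trans ?_
          exact avgNorm_mono sdiff_subset _
      _ = C₁ * μ (Metric.ball x √t) ^ e * ((2⁻¹ : ℝ≥0∞) ^ (n + 1) *
          avgNorm μ p (Metric.ball x (2 ^ (n + 1 + 2) * √t))
            (Metric.ball x (2 ^ (n + 1 + 2) * √t)) f) := by ring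
      _ ≤ _ := by
          gcongr
          exact le_add_self

theorem tsum_two_inv_pow : ∑' i : ℕ, (2⁻¹ : ℝ≥0∞) ^ i = 2 := by
  rw [ENNReal.tsum_geometric, ENNReal.one_sub_inv_two, inv_inv]

omit [MeasurableSpace X] [BorelSpace X] in
theorem eventually_mem_ball_two_pow (x : X) {ρ : ℝ} (hρ : 0 < ρ) (y : X) :
    ∀ᶠ n : ℕ in atTop, y ∈ Metric.ball x (2 ^ (n + 2) * ρ) := by
  have h : Tendsto (fun n : ℕ => (2 : ℝ) ^ (n + 2) * ρ) atTop atTop :=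
    ((tendsto_pow_atTop_atTop_of_one_lt one_lt_two).comp (tendsto_add_atTop_nat 2)).atTop_mul_const hρ
  exact (h.eventually_gt_atTop (dist y x)).mono fun n hn => hn

/-- The local bounds are summed over a net of mesh `√t`. The weighted overlap of the balls of radius
`2^(i+2) √t` is bounded independently of `i`, so the weights `2^(-i)` suffice for convergence. -/
theorem OffDiagonalLp.exists_eLpNorm_le [Nonempty X]
    (hd : ∀ (x : X) (r : ℝ), 0 < r →
      μ (Metric.ball x (2 * r)) ≤ C₀ * μ (Metric.ball x r) ∧ μ (Metric.ball x r) < ∞)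
    (hr : r ≠ ∞) (hp : 1 ≤ p) (hU : OffDiagonalLp U p p) :
    ∃ C : ℝ≥0, ∀ t : ℝ, 0 < t → ∀ f : Lp 𝕜 r μ, eLpNorm (U t f) p μ ≤ C * eLpNorm f p μ := by
  rcases eq_or_ne μ 0 with hμ | hμ
  · exact ⟨0, fun t _ f => by simp [hμ]⟩
  obtain ⟨C, hC⟩ := hU.exists_eLpNorm_truncLp_le hd hμ hp
  have hlim : ∀ t : ℝ, 0 < t → ∀ (x : X) (f : Lp 𝕜 r μ), Tendsto (fun n : ℕ =>
      U t (truncLp (measurableSet_ball (x := x) (ε := 2 ^ (n + 2) * √t)) f)) atTop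
      (𝓝 (U t f)) := fun t ht x f => ((U t).continuous.tendsto f).comp
        (tendsto_truncLp hr _ (eventually_mem_ball_two_pow x (Real.sqrt_pos.2 ht)) f)
  have hac : ∀ s : Set X, μ.restrict s ≪ μ := fun s => Measure.restrict_le_self.absolutelyContinuous
  have hwsum : ∀ n : ℕ, ∑ i ∈ Finset.range (n + 1), (2⁻¹ : ℝ≥0∞) ^ i ≤ 2 := fun n =>
    (ENNReal.sum_le_tsum _).trans tsum_two_inv_pow.le
  rcases eq_or_ne p ∞ with rfl | hp'
  · refine ⟨C * 2, fun t ht f => ?_⟩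
    have hρ : 0 < √t := Real.sqrt_pos.2 ht
    obtain ⟨s, hs, hcov, -⟩ := exists_countable_net hd hμ hρ
    have := hs.to_subtype
    have hloc : ∀ x : X, eLpNorm (U t f) ∞ (μ.restrict (Metric.ball x √t)) ≤
        C * 2 * eLpNorm f ∞ μ := by
      intro x
      refine eLpNorm_le_of_tendsto_Lp (hlim t ht x f) (hac _) fun n => (hC t ht x f n).trans ?_
      simp only [ENNReal.div_top, ENNReal.toReal_zero, ENNReal.rpow_zero, mul_one]
      rw [mul_assoc]
      refine mul_le_mul_right ?_ _
      calc _ ≤ ∑ i ∈ Finset.range (n + 1), (2⁻¹ : ℝ≥0∞) ^ i * eLpNorm f ∞ μ := by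
            refine Finset.sum_le_sum fun i _ => mul_le_mul_right ?_ _
            rw [avgNorm_eq _ (hd x _ (by positivity)).2.ne]
            simpa using eLpNormEssSup_mono_measure (f : X → 𝕜) (hac (Metric.ball x _))
        _ ≤ 2 * eLpNorm f ∞ μ := by
            rw [← Finset.sum_mul]
            gcongr
            exact hwsum n
    rw [eLpNorm_exponent_top]
    refine eLpNormEssSup_le_of_ae_enorm_bound ?_
    suffices h : ∀ᵐ y ∂μ.restrict univ, ‖U t f y‖ₑ ≤ ↑(C * 2) * eLpNorm f ∞ μ by
      rwa [Measure.restrict_univ] at h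
    rw [← hcov, ae_restrict_iUnion_iff]
    intro x
    have h1 := hloc x
    rw [eLpNorm_exponent_top] at h1
    filter_upwards [enorm_ae_le_eLpNormEssSup (U t f : X → 𝕜) (μ.restrict (Metric.ball (x : X) √t))]
      with y hy
    exact_mod_cast hy.trans h1
  · have hp0 : p ≠ 0 := (zero_lt_one.trans_le hp).ne'
    set e := p.toReal with he
    have he1 : 1 ≤ e := by
      rw [he, ← ENNReal.toReal_one]; exact ENNReal.toReal_mono hp' hp
    have he0 : 0 < e := zero_lt_one.trans_le he1
    have hinv : (1 / p).toReal = e⁻¹ := by rw [one_div, ENNReal.toReal_inv]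
    have hpow : ∀ (h : X → 𝕜) (ν : Measure X), eLpNorm h p ν ^ e = ∫⁻ y, ‖h y‖ₑ ^ e ∂ν := by
      intro h ν
      rw [eLpNorm_eq_lintegral_rpow_enorm_toReal hp0 hp', ← ENNReal.rpow_mul, one_div,
        inv_mul_cancel₀ he0.ne', ENNReal.rpow_one]
    set K : ℝ≥0∞ := (C * 2 : ℝ≥0∞) ^ e with hK
    have hloc : ∀ t : ℝ, 0 < t → ∀ (f : Lp 𝕜 r μ) (x : X),
        ∫⁻ y in Metric.ball x √t, ‖U t f y‖ₑ ^ e ∂μ ≤ K * (μ (Metric.ball x √t) *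
          ∑' i : ℕ, (2⁻¹ : ℝ≥0∞) ^ i * ((μ (Metric.ball x (2 ^ (i + 2) * √t)))⁻¹ *
            ∫⁻ y in Metric.ball x (2 ^ (i + 2) * √t), ‖f y‖ₑ ^ e ∂μ)) := by
      intro t ht f x
      have hρ : 0 < √t := Real.sqrt_pos.2 ht
      set Z := ∑' i : ℕ, (2⁻¹ : ℝ≥0∞) ^ i * ((μ (Metric.ball x (2 ^ (i + 2) * √t)))⁻¹ *
            ∫⁻ y in Metric.ball x (2 ^ (i + 2) * √t), ‖f y‖ₑ ^ e ∂μ) with hZ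
      have havg : ∀ i : ℕ, avgNorm μ p (Metric.ball x (2 ^ (i + 2) * √t))
            (Metric.ball x (2 ^ (i + 2) * √t)) f ^ e = (μ (Metric.ball x (2 ^ (i + 2) * √t)))⁻¹ *
            ∫⁻ y in Metric.ball x (2 ^ (i + 2) * √t), ‖f y‖ₑ ^ e ∂μ := by
        intro i
        rw [avgNorm, hpow, lintegral_smul_measure, smul_eq_mul]
      have h1 : eLpNorm (U t f) p (μ.restrict (Metric.ball x √t)) ≤
          C * μ (Metric.ball x √t) ^ e⁻¹ * (2 * Z ^ e⁻¹) := by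
        refine eLpNorm_le_of_tendsto_Lp (hlim t ht x f) (hac _) fun n => (hC t ht x f n).trans ?_
        rw [hinv]
        -- Hölder with the weights `2^(-i)`, of total mass at most `2`, moves the power `e` inside
        -- the sum.
        refine mul_le_mul_right ((ENNReal.inner_le_weight_mul_Lp_of_nonneg _ he1 _ _).trans ?_) _
        refine mul_le_mul' ?_ (ENNReal.rpow_le_rpow ?_ (inv_nonneg.2 he0.le))
        · calc _ ≤ (2 : ℝ≥0∞) ^ (1 - e⁻¹) :=
                ENNReal.rpow_le_rpow (hwsum n) (sub_nonneg.2 (inv_le_one_of_one_le₀ he1))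
            _ ≤ 2 ^ (1 : ℝ) := ENNReal.rpow_le_rpow_of_exponent_le (by norm_num)
                (by linarith [inv_nonneg.2 he0.le])
            _ = 2 := ENNReal.rpow_one _
        · simp only [havg]
          exact ENNReal.sum_le_tsum _
      rw [← hpow]
      refine (ENNReal.rpow_le_rpow h1 he0.le).trans_eq ?_
      have hcancel : ∀ a : ℝ≥0∞, (a ^ e⁻¹) ^ e = a := fun a => by
        rw [← ENNReal.rpow_mul, inv_mul_cancel₀ he0.ne', ENNReal.rpow_one]
      rw [show (C : ℝ≥0∞) * μ (Metric.ball x √t) ^ e⁻¹ * (2 * Z ^ e⁻¹) =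
        (C * 2) * (μ (Metric.ball x √t) ^ e⁻¹ * Z ^ e⁻¹) by ring,
        ENNReal.mul_rpow_of_nonneg (C * 2) _ he0.le,
        ENNReal.mul_rpow_of_nonneg (μ (Metric.ball x √t) ^ e⁻¹) _ he0.le, hcancel, hcancel]
    have hglob : ∀ t : ℝ, 0 < t → ∀ f : Lp 𝕜 r μ,
        ∫⁻ y, ‖U t f y‖ₑ ^ e ∂μ ≤ K * (2 * C₀ ^ 5 * ∫⁻ y, ‖f y‖ₑ ^ e ∂μ) := by
      intro t ht f
      have hρ : 0 < √t := Real.sqrt_pos.2 ht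
      obtain ⟨s, hs, hcov, hover⟩ := exists_countable_net hd hμ hρ
      have := hs.to_subtype
      have hfm : AEMeasurable (fun y => ‖f y‖ₑ ^ e) μ :=
        (Lp.aestronglyMeasurable f).enorm.pow_const e
      calc ∫⁻ y, ‖U t f y‖ₑ ^ e ∂μ
          = ∫⁻ y in ⋃ x : s, Metric.ball (x : X) √t, ‖U t f y‖ₑ ^ e ∂μ := by
            rw [hcov, Measure.restrict_univ]
        _ ≤ ∑' x : s, ∫⁻ y in Metric.ball (x : X) √t, ‖U t f y‖ₑ ^ e ∂μ :=
            lintegral_iUnion_le _ _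
        _ ≤ ∑' x : s, K * (μ (Metric.ball (x : X) √t) *
          ∑' i : ℕ, (2⁻¹ : ℝ≥0∞) ^ i * ((μ (Metric.ball (x : X) (2 ^ (i + 2) * √t)))⁻¹ *
            ∫⁻ y in Metric.ball (x : X) (2 ^ (i + 2) * √t), ‖f y‖ₑ ^ e ∂μ)) :=
            ENNReal.tsum_le_tsum fun x => hloc t ht f x
        _ = K * ∑' i : ℕ, (2⁻¹ : ℝ≥0∞) ^ i * ∑' x : s,
            ∫⁻ y, (Metric.ball (x : X) (2 ^ (i + 2) * √t)).indicator (fun _ =>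
              μ (Metric.ball (x : X) √t) * (μ (Metric.ball (x : X) (2 ^ (i + 2) * √t)))⁻¹) y *
              ‖f y‖ₑ ^ e ∂μ := by
            rw [ENNReal.tsum_mul_left]
            congr 1
            simp_rw [← ENNReal.tsum_mul_left]
            rw [ENNReal.tsum_comm]
            refine tsum_congr fun i => tsum_congr fun x => ?_
            have e1 : ∀ y, (Metric.ball (x : X) (2 ^ (i + 2) * √t)).indicator (fun _ =>
                μ (Metric.ball (x : X) √t) * (μ (Metric.ball (x : X) (2 ^ (i + 2) * √t)))⁻¹) y *
                ‖f y‖ₑ ^ e = (Metric.ball (x : X) (2 ^ (i + 2) * √t)).indicator (fun y =>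
                μ (Metric.ball (x : X) √t) * (μ (Metric.ball (x : X) (2 ^ (i + 2) * √t)))⁻¹ *
                ‖f y‖ₑ ^ e) y := fun y => by
              by_cases hy : y ∈ Metric.ball (x : X) (2 ^ (i + 2) * √t) <;> simp [hy]
            simp_rw [e1]
            rw [lintegral_indicator measurableSet_ball,
              lintegral_const_mul'' _ hfm.restrict]
            ring
        _ ≤ K * ∑' i : ℕ, (2⁻¹ : ℝ≥0∞) ^ i * (C₀ ^ 5 * ∫⁻ y, ‖f y‖ₑ ^ e ∂μ) := by
            refine mul_le_mul_right (ENNReal.tsum_le_tsum fun i => mul_le_mul_right ?_ _) _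
            refine (lintegral_tsum (f := fun (x : s) y =>
              (Metric.ball (x : X) (2 ^ (i + 2) * √t)).indicator (fun _ =>
                μ (Metric.ball (x : X) √t) * (μ (Metric.ball (x : X) (2 ^ (i + 2) * √t)))⁻¹) y *
                ‖f y‖ₑ ^ e) fun x =>
              ((aemeasurable_const.indicator measurableSet_ball).mul hfm)).symm.trans_le ?_
            rw [← lintegral_const_mul'' _ hfm]
            refine lintegral_mono fun y => ?_
            rw [ENNReal.tsum_mul_right]
            refine mul_le_mul_left (hover _ ?_ y) _
            have : (1 : ℝ) ≤ 2 ^ (i + 2) := one_le_pow₀ (by norm_num)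
            nlinarith
        _ = _ := by rw [ENNReal.tsum_mul_right, tsum_two_inv_pow]; ring
    refine ⟨(((C * 2) ^ e * (2 * C₀ ^ 5)) ^ e⁻¹ : ℝ≥0), fun t ht f => ?_⟩
    have h1 := hglob t ht f
    rw [← hpow, ← hpow, ← mul_assoc] at h1
    have h2 := ENNReal.rpow_le_rpow h1 (inv_nonneg.2 he0.le)
    have hcancel : ∀ a : ℝ≥0∞, (a ^ e) ^ e⁻¹ = a := fun a => by
      rw [← ENNReal.rpow_mul, mul_inv_cancel₀ he0.ne', ENNReal.rpow_one]
    rw [ENNReal.mul_rpow_of_nonneg _ _ (inv_nonneg.2 he0.le), hcancel, hcancel] at h2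
    rw [ENNReal.coe_rpow_of_nonneg _ (inv_nonneg.2 he0.le)]
    push_cast
    rw [ENNReal.coe_rpow_of_nonneg _ he0.le]
    push_cast
    exact h2

end UniformBound

/-! ### Decay away from the support -/

section Tail

theorem eLpNorm_le_add_compl {X : Type*} [MeasurableSpace X] {𝕜 : Type*} [RCLike 𝕜] {μ : Measure X}
    {q : ℝ≥0∞} (hq : 1 ≤ q) {E : Set X} (hE : MeasurableSet E) {h : X → 𝕜}
    (hh : AEStronglyMeasurable h μ) :
    eLpNorm h q μ ≤ eLpNorm h q (μ.restrict E) + eLpNorm h q (μ.restrict Eᶜ) := by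
  rw [← eLpNorm_indicator_eq_eLpNorm_restrict hE, ← eLpNorm_indicator_eq_eLpNorm_restrict hE.compl]
  refine le_trans (le_of_eq ?_) (eLpNorm_add_le (hh.indicator hE) (hh.indicator hE.compl) hq)
  rw [indicator_self_add_compl]

variable {X : Type*} [MetricSpace X] [MeasurableSpace X] [BorelSpace X]
  {𝕜 : Type*} [RCLike 𝕜] {μ : Measure X} {C₀ : ℝ≥0} {r : ℝ≥0∞} [Fact (1 ≤ r)]
  {U : ℝ → Lp 𝕜 r μ →L[𝕜] Lp 𝕜 r μ} {p q : ℝ≥0∞}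

theorem eLpNorm_compl_ball_le_tsum (hr : r ≠ ∞) (hq : 1 ≤ q) (x : X) {ρ : ℝ} (hρ : 0 < ρ)
    (h : Lp 𝕜 r μ) : eLpNorm h q (μ.restrict (Metric.ball x (4 * ρ))ᶜ) ≤
      ∑' i : ℕ, eLpNorm h q (μ.restrict (annulus x ρ (i + 2))) := by
  have hac : μ.restrict (Metric.ball x (4 * ρ))ᶜ ≪ μ :=
    Measure.restrict_le_self.absolutelyContinuous
  refine eLpNorm_le_of_tendsto_Lp (tendsto_truncLp hr (fun n => measurableSet_ball)
    (eventually_mem_ball_two_pow x hρ) h) hac fun n => ?_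
  refine le_trans ?_ (ENNReal.sum_le_tsum (Finset.range n))
  induction n with
  | zero =>
    rw [Finset.range_zero, Finset.sum_empty, nonpos_iff_eq_zero,
      eLpNorm_congr_ae (hac.ae_le (coeFn_truncLp _ h)),
      eLpNorm_indicator_eq_eLpNorm_restrict measurableSet_ball,
      Measure.restrict_restrict measurableSet_ball]
    norm_num
  | succ n ih =>
    have hsplit : truncLp (measurableSet_ball (x := x) (ε := 2 ^ (n + 1 + 2) * ρ)) h =
        truncLp (measurableSet_ball (x := x) (ε := 2 ^ (n + 2) * ρ)) h +
          truncLp (measurableSet_annulus x ρ (n + 2)) h := by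
      rw [← truncLp_add_truncLp_of_disjoint _ _ (disjoint_ball_annulus x ρ (n + 2))]
      simp only [ball_union_annulus x hρ]
    rw [hsplit, Finset.sum_range_succ, eLpNorm_congr_ae (hac.ae_le (Lp.coeFn_add _ _))]
    refine (eLpNorm_add_le ((Lp.aestronglyMeasurable _).mono_ac hac)
      ((Lp.aestronglyMeasurable _).mono_ac hac) hq).trans (add_le_add ih ?_)
    refine (eLpNorm_restrict_le _ _ _ _).trans_eq ?_
    rw [eLpNorm_congr_ae (coeFn_truncLp _ h),
      eLpNorm_indicator_eq_eLpNorm_restrict (measurableSet_annulus x ρ (n + 2))]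

/-- The ball is fixed while `t` varies, so `K` may depend on the ball; what matters is the positive
power of `√t`. -/
theorem OffDiagonalLp.exists_eLpNorm_compl_ball_le
    (hd : ∀ (x : X) (r : ℝ), 0 < r →
      μ (Metric.ball x (2 * r)) ≤ C₀ * μ (Metric.ball x r) ∧ μ (Metric.ball x r) < ∞)
    (hr : r ≠ ∞) (hq : 1 ≤ q) (hU : OffDiagonalLp U p q) :
    ∃ m : ℕ, 0 < m ∧ ∀ (x : X) (ρ : ℝ), 0 < ρ → ∃ K : ℝ≥0∞, K ≠ ∞ ∧ ∀ t : ℝ, 0 < t →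
      ∀ f : Lp 𝕜 r μ, (∀ᵐ y ∂μ, y ∉ Metric.ball x ρ → f y = 0) →
        eLpNorm (U t f) q (μ.restrict (Metric.ball x (4 * ρ))ᶜ) ≤
          K * ENNReal.ofReal (√t ^ m) * eLpNorm f p μ := by
  rcases eq_or_ne μ 0 with hμ | hμ
  · exact ⟨1, one_pos, fun x ρ hρ => ⟨0, ENNReal.zero_ne_top, fun t _ f _ => by simp [hμ]⟩⟩
  -- Volumes grow by at most `2^k` per dyadic step, so decay of order `k + 1` leaves a convergent
  -- geometric series.
  obtain ⟨k, hk⟩ := pow_unbounded_of_one_lt C₀ (one_lt_two (α := ℝ≥0))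
  obtain ⟨m, hm, C, hC⟩ := hU.2 (k + 1)
  refine ⟨m, hm, fun x ρ hρ => ?_⟩
  have hB0 := (measure_ball_pos_of_doubling hd hμ x hρ).ne'
  have hB := (hd x ρ hρ).2.ne
  set V := μ (Metric.ball x ρ) with hV
  set a := (1 / q).toReal with ha
  set b := (1 / p).toReal with hb
  have ha0 : 0 ≤ a := ENNReal.toReal_nonneg
  have hb0 : 0 ≤ b := ENNReal.toReal_nonneg
  have ha1 : a ≤ 1 := by
    rw [ha, one_div, ← ENNReal.toReal_one]
    exact ENNReal.toReal_mono ENNReal.one_ne_top (ENNReal.inv_le_one.2 hq)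
  have hVa : V ^ a ≠ ∞ := ENNReal.rpow_ne_top_of_nonneg ha0 hB
  have hVb : V⁻¹ ^ b ≠ ∞ := ENNReal.rpow_ne_top_of_nonneg hb0 (ENNReal.inv_ne_top.2 hB0)
  refine ⟨V ^ a * C * 2 ^ k * ENNReal.ofReal (ρ⁻¹ ^ m) * V⁻¹ ^ b * 2, ?_, fun t ht f hf => ?_⟩
  · finiteness
  refine (eLpNorm_compl_ball_le_tsum hr hq x hρ (U t f)).trans ?_
  have hterm : ∀ i : ℕ, eLpNorm (U t f) q (μ.restrict (annulus x ρ (i + 2))) ≤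
      (2⁻¹ : ℝ≥0∞) ^ i * (V ^ a * C * 2 ^ k * ENNReal.ofReal (ρ⁻¹ ^ m) * V⁻¹ ^ b *
        ENNReal.ofReal (√t ^ m) * eLpNorm f p μ) := by
    intro i
    have hR : 0 < (2 : ℝ) ^ (i + 2 + 1) * ρ := by positivity
    have h1 := (hC t ht x ρ hρ (i + 2) (by omega) f).2 hf
    have h2 : avgNorm μ p (Metric.ball x ρ) (Metric.ball x ρ) f ≤ V⁻¹ ^ b * eLpNorm f p μ := by
      rw [avgNorm_eq p hB]
      gcongr
      exact Measure.restrict_le_self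
    have h3 : μ (Metric.ball x (2 ^ (i + 2 + 1) * ρ)) ^ a ≤ 2 ^ (k * (i + 3)) * V ^ a := by
      have h4 : μ (Metric.ball x (2 ^ (i + 2 + 1) * ρ)) ≤ 2 ^ (k * (i + 3)) * V := by
        refine (measure_ball_two_pow_le hd x hρ (i + 2 + 1)).trans ?_
        rw [pow_mul]
        gcongr
        exact_mod_cast hk.le
      refine (ENNReal.rpow_le_rpow h4 ha0).trans ?_
      rw [ENNReal.mul_rpow_of_nonneg _ _ ha0]
      gcongr
      calc ((2 : ℝ≥0∞) ^ (k * (i + 3))) ^ a ≤ ((2 : ℝ≥0∞) ^ (k * (i + 3))) ^ (1 : ℝ) :=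
            ENNReal.rpow_le_rpow_of_exponent_le (one_le_pow₀ (by norm_num)) ha1
        _ = _ := ENNReal.rpow_one _
    have h5 : (2 : ℝ≥0∞) ^ (k * (i + 3)) *
        ENNReal.ofReal (((2 : ℝ) ^ (i + 2))⁻¹ ^ (k + 1) * (√t / ρ) ^ m) ≤
        (2⁻¹ : ℝ≥0∞) ^ i * 2 ^ k * (ENNReal.ofReal (ρ⁻¹ ^ m) * ENNReal.ofReal (√t ^ m)) := by
      have e1 : (2 : ℝ≥0∞) = ENNReal.ofReal 2 := by norm_num
      have e2 : (2⁻¹ : ℝ≥0∞) = ENNReal.ofReal 2⁻¹ := by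
        rw [ENNReal.ofReal_inv_of_pos (by norm_num)]; norm_num
      rw [e2, e1, ← ENNReal.ofReal_pow (by norm_num), ← ENNReal.ofReal_pow (by norm_num),
        ← ENNReal.ofReal_pow (by norm_num), ← ENNReal.ofReal_mul (by positivity),
        ← ENNReal.ofReal_mul (by positivity), ← ENNReal.ofReal_mul (by positivity),
        ← ENNReal.ofReal_mul (by positivity)]
      refine ENNReal.ofReal_le_ofReal ?_
      have e3 : (2 : ℝ) ^ (k * (i + 3)) * (((2 : ℝ) ^ (i + 2))⁻¹ ^ (k + 1)) =
          2⁻¹ ^ i * 2 ^ k * (2⁻¹) ^ 2 := by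
        have e4 : (2 : ℝ) ^ (k * (i + 2)) * ((2 : ℝ) ^ (i + 2))⁻¹ ^ k = 1 := by
          rw [mul_comm k, pow_mul, ← mul_pow, mul_inv_cancel₀ (by positivity), one_pow]
        calc (2 : ℝ) ^ (k * (i + 3)) * (((2 : ℝ) ^ (i + 2))⁻¹ ^ (k + 1))
            = ((2 : ℝ) ^ (k * (i + 2)) * ((2 : ℝ) ^ (i + 2))⁻¹ ^ k) *
              (2 ^ k * ((2 : ℝ) ^ (i + 2))⁻¹) := by ring
          _ = _ := by rw [e4, ← inv_pow]; ring
      calc _ = (2⁻¹ ^ i * 2 ^ k * (2⁻¹ : ℝ) ^ 2) * (√t / ρ) ^ m := by rw [← mul_assoc, e3]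
        _ ≤ (2⁻¹ ^ i * 2 ^ k * 1) * (√t / ρ) ^ m := by gcongr; norm_num
        _ = _ := by rw [div_eq_mul_inv, mul_pow]; ring
    rw [eLpNorm_restrict_eq_avgNorm q (measure_ball_pos_of_doubling hd hμ x hR).ne' (hd x _ hR).2.ne]
    calc _ ≤ (2 ^ (k * (i + 3)) * V ^ a) * (C *
          ENNReal.ofReal (((2 : ℝ) ^ (i + 2))⁻¹ ^ (k + 1) * (√t / ρ) ^ m) *
          (V⁻¹ ^ b * eLpNorm f p μ)) :=
          mul_le_mul' h3 (h1.trans (mul_le_mul_right h2 _))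
      _ = V ^ a * C * V⁻¹ ^ b * eLpNorm f p μ * (2 ^ (k * (i + 3)) *
          ENNReal.ofReal (((2 : ℝ) ^ (i + 2))⁻¹ ^ (k + 1) * (√t / ρ) ^ m)) := by ring
      _ ≤ V ^ a * C * V⁻¹ ^ b * eLpNorm f p μ * ((2⁻¹ : ℝ≥0∞) ^ i * 2 ^ k *
          (ENNReal.ofReal (ρ⁻¹ ^ m) * ENNReal.ofReal (√t ^ m))) := mul_le_mul_right h5 _
      _ = _ := by ring
  refine (ENNReal.tsum_le_tsum hterm).trans_eq ?_
  rw [ENNReal.tsum_mul_right, tsum_two_inv_pow]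
  ring

/-- Smoothing from `L^p` to `L^q` at a fixed time. It is not uniform in the ball: the on-diagonal
estimate on `B(x, 4ρ)` is combined with the tail bound outside. -/
theorem OffDiagonalLp.exists_eLpNorm_le_of_support
    (hd : ∀ (x : X) (r : ℝ), 0 < r →
      μ (Metric.ball x (2 * r)) ≤ C₀ * μ (Metric.ball x r) ∧ μ (Metric.ball x r) < ∞)
    (hr : r ≠ ∞) (hq : 1 ≤ q) (hU : OffDiagonalLp U p q) (x : X) {ρ : ℝ} (hρ : 0 < ρ)
    {t : ℝ} (ht : 0 < t) :
    ∃ K : ℝ≥0∞, K ≠ ∞ ∧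
      ∀ f : Lp 𝕜 r μ, (∀ᵐ y ∂μ, y ∉ Metric.ball x ρ → f y = 0) →
        eLpNorm (U t f) q μ ≤ K * eLpNorm f p μ := by
  rcases eq_or_ne μ 0 with hμ | hμ
  · exact ⟨0, ENNReal.zero_ne_top, fun f _ => by simp [hμ]⟩
  obtain ⟨m, -, hm⟩ := hU.exists_eLpNorm_compl_ball_le hd hr hq
  obtain ⟨K, hK, hK'⟩ := hm x ρ hρ
  obtain ⟨⟨D, hD⟩, -⟩ := hU
  have hR : 0 < 4 * ρ := by positivity
  have hB0 := (measure_ball_pos_of_doubling hd hμ x hR).ne'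
  have hB := (hd x _ hR).2.ne
  have h1 : μ (Metric.ball x (4 * ρ)) ^ (1 / q).toReal ≠ ∞ :=
    ENNReal.rpow_ne_top_of_nonneg ENNReal.toReal_nonneg hB
  have h2 : (μ (Metric.ball x (4 * ρ)))⁻¹ ^ (1 / p).toReal ≠ ∞ :=
    ENNReal.rpow_ne_top_of_nonneg ENNReal.toReal_nonneg (ENNReal.inv_ne_top.2 hB0)
  refine ⟨μ (Metric.ball x (4 * ρ)) ^ (1 / q).toReal * (D (4 * ρ / √t) *
    (μ (Metric.ball x (4 * ρ)))⁻¹ ^ (1 / p).toReal) + K * ENNReal.ofReal (√t ^ m), ?_,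
    fun f hf => ?_⟩
  · finiteness
  refine (eLpNorm_le_add_compl hq (E := Metric.ball x (4 * ρ)) measurableSet_ball (Lp.aestronglyMeasurable _)).trans ?_
  rw [add_mul]
  refine add_le_add ?_ (hK' t ht f hf)
  have h3 := hD t ht x _ hR f (hf.mono fun y hy hyR => hy fun hy' =>
    hyR (Metric.ball_subset_ball (by linarith) hy'))
  rw [eLpNorm_restrict_eq_avgNorm q hB0 hB]
  calc _ ≤ μ (Metric.ball x (4 * ρ)) ^ (1 / q).toReal * (D (4 * ρ / √t) *
        ((μ (Metric.ball x (4 * ρ)))⁻¹ ^ (1 / p).toReal * eLpNorm f p μ)) := by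
        refine mul_le_mul_right (h3.trans (mul_le_mul_right ?_ _)) _
        rw [avgNorm_eq p hB]
        exact mul_le_mul_right (eLpNorm_restrict_le _ _ _ _) _
    _ = _ := by ring

end Tail

/-! ### Interpolation between Lebesgue norms -/

section Interpolation

variable {X : Type*} [MeasurableSpace X] {𝕜 : Type*} [RCLike 𝕜] {μ : Measure X}

/-- Hölder applied to `|h| = |h|^θ |h|^(1-θ)`, with `1/p = (1-θ)/a + θ/q`; the case `q = ∞` is
included. -/
theorem exists_interpolation_exponent {a p q : ℝ≥0∞} (ha : 1 ≤ a) (hap : a < p) (hpq : p < q) :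
    ∃ θ : ℝ, 0 < θ ∧ θ < 1 ∧ ∀ h : X → 𝕜, AEStronglyMeasurable h μ →
      eLpNorm h p μ ≤ eLpNorm h a μ ^ (1 - θ) * eLpNorm h q μ ^ θ := by
  have hp1 : 1 ≤ p := ha.trans hap.le
  have ha0 : a ≠ 0 := (zero_lt_one.trans_le ha).ne'
  have hp0 : p ≠ 0 := (zero_lt_one.trans_le hp1).ne'
  have hq0 : q ≠ 0 := (zero_lt_one.trans_le (hp1.trans hpq.le)).ne'
  have hai : a⁻¹ ≠ ∞ := ENNReal.inv_ne_top.2 ha0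
  have hpi : p⁻¹ ≠ ∞ := ENNReal.inv_ne_top.2 hp0
  have hqi : q⁻¹ ≠ ∞ := ENNReal.inv_ne_top.2 hq0
  have h1 : (p⁻¹).toReal < (a⁻¹).toReal :=
    (ENNReal.toReal_lt_toReal hpi hai).2 (ENNReal.inv_lt_inv.2 hap)
  have h2 : (q⁻¹).toReal < (p⁻¹).toReal :=
    (ENNReal.toReal_lt_toReal hqi hpi).2 (ENNReal.inv_lt_inv.2 hpq)
  set α := (a⁻¹).toReal with hα
  set β := (q⁻¹).toReal with hβ
  set γ := (p⁻¹).toReal with hγ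
  have hαβ : 0 < α - β := by linarith
  set θ := (α - γ) / (α - β) with hθ
  have hθ0 : 0 < θ := div_pos (by linarith) hαβ
  have hθ1 : θ < 1 := (div_lt_one hαβ).2 (by linarith)
  have hcomb : (1 - θ) * α + θ * β = γ := by
    rw [hθ]; field_simp; ring
  have hθ1' : 0 < 1 - θ := by linarith
  refine ⟨θ, hθ0, hθ1, fun h hh => ?_⟩
  have hc1 : ENNReal.ofReal (1 - θ) ≠ 0 := (ENNReal.ofReal_pos.2 hθ1').ne'
  have hc2 : ENNReal.ofReal θ ≠ 0 := (ENNReal.ofReal_pos.2 hθ0).ne'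
  have htriple : ENNReal.HolderTriple (a / ENNReal.ofReal (1 - θ)) (q / ENNReal.ofReal θ) p := by
    constructor
    rw [ENNReal.inv_div (Or.inl ENNReal.ofReal_ne_top) (Or.inl hc1),
      ENNReal.inv_div (Or.inl ENNReal.ofReal_ne_top) (Or.inl hc2), div_eq_mul_inv, div_eq_mul_inv,
      ← ENNReal.ofReal_toReal hai, ← ENNReal.ofReal_toReal hqi, ← ENNReal.ofReal_toReal hpi,
      ← ENNReal.ofReal_mul hθ1'.le, ← ENNReal.ofReal_mul hθ0.le,
      ← ENNReal.ofReal_add (by positivity) (by positivity), hcomb]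
  have hm : ∀ c : ℝ, AEStronglyMeasurable (fun x => ‖h x‖ ^ c) μ := fun c =>
    (hh.norm.aemeasurable.pow_const c).aestronglyMeasurable
  have h3 := eLpNorm_smul_le_mul_eLpNorm (hm θ) (hm (1 - θ)) (hpqr := htriple)
  rw [eLpNorm_norm_rpow h hθ1', eLpNorm_norm_rpow h hθ0,
    ENNReal.div_mul_cancel hc1 ENNReal.ofReal_ne_top,
    ENNReal.div_mul_cancel hc2 ENNReal.ofReal_ne_top] at h3
  refine le_trans (le_of_eq ?_) h3
  rw [← eLpNorm_norm h]
  congr 1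
  ext x
  rcases (norm_nonneg (h x)).eq_or_lt with h0 | h0
  · simp [← h0, Real.zero_rpow hθ0.ne']
  · simp only [Pi.smul_apply', smul_eq_mul]
    rw [← Real.rpow_add h0, sub_add_cancel, Real.rpow_one]

theorem tendsto_eLpNorm_zero_of_interpolation {a p q : ℝ≥0∞} (ha : 1 ≤ a) (hap : a < p)
    (hpq : p < q) {ι : Type*} {l : Filter ι} {h : ι → X → 𝕜}
    (hm : ∀ i, AEStronglyMeasurable (h i) μ)
    (hlim : Tendsto (fun i => eLpNorm (h i) a μ) l (𝓝 0)) {K : ℝ≥0∞} (hK : K ≠ ∞)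
    (hb : ∀ᶠ i in l, eLpNorm (h i) q μ ≤ K) : Tendsto (fun i => eLpNorm (h i) p μ) l (𝓝 0) := by
  obtain ⟨θ, hθ0, hθ1, hθ⟩ := exists_interpolation_exponent (𝕜 := 𝕜) (μ := μ) ha hap hpq
  have h1 : Tendsto (fun i => eLpNorm (h i) a μ ^ (1 - θ) * K ^ θ) l (𝓝 0) := by
    have := ENNReal.Tendsto.mul_const (b := K ^ θ) (hlim.ennrpow_const (1 - θ))
      (Or.inr (ENNReal.rpow_ne_top_of_nonneg hθ0.le hK))
    simpa [ENNReal.zero_rpow_of_pos (sub_pos.2 hθ1)] using this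
  refine tendsto_of_tendsto_of_tendsto_of_le_of_le' tendsto_const_nhds h1
    (Eventually.of_forall fun _ => zero_le) ?_
  filter_upwards [hb] with i hi
  refine (hθ _ (hm i)).trans ?_
  gcongr

end Interpolation

/-! ### A Banach–Saks argument for almost everywhere limits -/

section BanachSaks

variable {X : Type*} [MeasurableSpace X] {𝕜 : Type*} [RCLike 𝕜] {μ : Measure X}
  {p : ℝ≥0∞} [Fact (1 ≤ p)]

/-- A bounded sequence tending to `0` almost everywhere is asymptotically disjoint from the fixed
function `S`, so the `p`-th powers of the norms nearly add. -/
theorem eventually_enorm_add_rpow_le (hp : p ≠ ∞) (S : Lp 𝕜 p μ) {h : ℕ → Lp 𝕜 p μ} {M : ℝ≥0}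
    (hM : ∀ n, ‖h n‖ₑ ≤ M) (hlim : ∀ᵐ x ∂μ, Tendsto (fun n => h n x) atTop (𝓝 0)) :
    ∀ᶠ n in atTop, ‖S + h n‖ₑ ^ p.toReal ≤ ‖S‖ₑ ^ p.toReal + (M ^ p.toReal + 1) := by
  have hp1 : 1 ≤ p := Fact.out
  have hp0 : p ≠ 0 := one_le_ne_zero
  set e := p.toReal with he
  have he0 : 0 < e := ENNReal.toReal_pos hp0 hp
  obtain ⟨η, hη0, hη⟩ : ∃ η : ℝ≥0, 0 < η ∧
      ((1 + η) * ‖S‖₊) ^ e + (η + M) ^ e < ‖S‖₊ ^ e + (M ^ e + 1) := by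
    have hc : Continuous fun η : ℝ≥0 => ((1 + η) * ‖S‖₊) ^ e + (η + M) ^ e := by
      have : Continuous fun x : ℝ≥0 => x ^ e := NNReal.continuous_rpow_const he0.le
      exact (this.comp (by fun_prop)).add (this.comp (by fun_prop))
    have h0 : ((1 + (0 : ℝ≥0)) * ‖S‖₊) ^ e + (0 + M) ^ e < ‖S‖₊ ^ e + (M ^ e + 1) := by
      rw [add_zero, one_mul, zero_add, ← add_assoc]
      exact lt_add_one _
    have h1 : ∀ᶠ η in 𝓝[>] (0 : ℝ≥0), ((1 + η) * ‖S‖₊) ^ e + (η + M) ^ e <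
        ‖S‖₊ ^ e + (M ^ e + 1) :=
      nhdsWithin_le_nhds (hc.continuousAt.eventually_lt continuousAt_const h0)
    obtain ⟨η, h2, h3⟩ := (h1.and self_mem_nhdsWithin).exists
    exact ⟨η, h3, h2⟩
  -- Off `A n` the sum is at most `(1 + η) |S|`. On `A n` the function `S` has small norm by
  -- dominated convergence, so the sum has norm at most `η + M`.
  set A : ℕ → Set X := fun n => {x | η * ‖S x‖ < ‖h n x‖} with hA
  have hAm : ∀ n, MeasurableSet (A n) := fun n => measurableSet_lt
    ((Lp.stronglyMeasurable S).norm.measurable.const_mul _) (Lp.stronglyMeasurable (h n)).norm.measurable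
  have hind : Tendsto (fun n => eLpNorm ((A n).indicator S) p μ) atTop (𝓝 0) := by
    refine tendsto_eLpNorm_zero_of_dominated hp0 hp
      (fun n => (Lp.aestronglyMeasurable S).indicator (hAm n)) (Lp.memLp S)
      (fun n => Eventually.of_forall fun x => norm_indicator_le_norm_self _ _) ?_
    filter_upwards [hlim] with x hx
    refine tendsto_const_nhds.congr' ?_
    rcases (norm_nonneg (S x)).eq_or_lt with h0 | h0
    · refine Eventually.of_forall fun n => ?_
      have h0' : S x = 0 := norm_eq_zero.1 h0.symm
      by_cases hxA : x ∈ A n <;> simp [hxA, h0']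
    · have h1 := hx.norm.eventually_lt_const (u := η * ‖S x‖) (by
        rw [norm_zero]; exact mul_pos hη0 h0)
      filter_upwards [h1] with n hn
      rw [indicator_of_notMem]
      exact not_lt.2 hn.le
  have hpow : ∀ (g : X → 𝕜) (ν : Measure X), ∫⁻ y, ‖g y‖ₑ ^ e ∂ν = eLpNorm g p ν ^ e := by
    intro g ν
    rw [eLpNorm_eq_lintegral_rpow_enorm_toReal hp0 hp, ← ENNReal.rpow_mul, one_div,
      inv_mul_cancel₀ he0.ne', ENNReal.rpow_one]
  filter_upwards [hind.eventually_lt_const (u := (η : ℝ≥0∞)) (ENNReal.coe_pos.2 hη0)] with n hn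
  have hfin : ((‖S‖₊ ^ e + (M ^ e + 1) : ℝ≥0) : ℝ≥0∞) =
      ‖S‖ₑ ^ e + (M ^ e + 1) := by
    push_cast
    rw [ENNReal.coe_rpow_of_nonneg _ he0.le, ENNReal.coe_rpow_of_nonneg _ he0.le]
    rfl
  rw [← hfin]
  refine le_trans ?_ (ENNReal.coe_le_coe.2 hη.le)
  push_cast
  rw [ENNReal.coe_rpow_of_nonneg _ he0.le, ENNReal.coe_rpow_of_nonneg _ he0.le, Lp.enorm_def,
    eLpNorm_congr_ae (Lp.coeFn_add S (h n)), ← hpow, ← lintegral_add_compl _ (hAm n), add_comm,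
    hpow, hpow]
  refine add_le_add (ENNReal.rpow_le_rpow ?_ he0.le) (ENNReal.rpow_le_rpow ?_ he0.le)
  · have h1 : ∀ᵐ x ∂μ.restrict (A n)ᶜ, ‖(S + h n : X → 𝕜) x‖ ≤ (1 + η) * ‖S x‖ := by
      refine (ae_restrict_iff' (hAm n).compl).2 (Eventually.of_forall fun x hx => ?_)
      have hx' : ‖h n x‖ ≤ η * ‖S x‖ := not_lt.1 hx
      calc ‖S x + h n x‖ ≤ ‖S x‖ + ‖h n x‖ := norm_add_le _ _
        _ ≤ _ := by linarith
    refine (eLpNorm_le_mul_eLpNorm_of_ae_le_mul h1 p).trans ?_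
    push_cast
    rw [ENNReal.ofReal_add zero_le_one (NNReal.coe_nonneg η), ENNReal.ofReal_one, ENNReal.ofReal_coe_nnreal]
    gcongr
    refine (eLpNorm_restrict_le _ _ _ _).trans_eq ?_
    rw [← Lp.enorm_def]
    rfl
  · refine (eLpNorm_add_le (Lp.aestronglyMeasurable S).restrict
      (Lp.aestronglyMeasurable (h n)).restrict hp1).trans ?_
    push_cast
    refine add_le_add ?_ ?_
    · rw [← eLpNorm_indicator_eq_eLpNorm_restrict (hAm n)]
      exact hn.le
    · refine (eLpNorm_restrict_le _ _ _ _).trans ?_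
      rw [← Lp.enorm_def]
      exact hM n

/-- For `1 < p < ∞`, a closed subspace of `L^p` contains the almost everywhere limits of its
bounded sequences. -/
theorem mem_of_tendsto_ae_of_bounded (hp1 : 1 < p) (hp : p ≠ ∞) (Y : Submodule 𝕜 (Lp 𝕜 p μ))
    (hY : IsClosed (Y : Set (Lp 𝕜 p μ))) {u : ℕ → Lp 𝕜 p μ} {g : Lp 𝕜 p μ}
    (hu : ∀ n, u n ∈ Y) {M : ℝ≥0} (hM : ∀ n, ‖u n‖ₑ ≤ M)
    (hlim : ∀ᵐ x ∂μ, Tendsto (fun n => u n x) atTop (𝓝 (g x))) : g ∈ Y := by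
  set e := p.toReal with he
  have he1 : 1 < e := by
    rw [he, ← ENNReal.toReal_one]; exact (ENNReal.toReal_lt_toReal ENNReal.one_ne_top hp).2 hp1
  have he0 : 0 < e := zero_lt_one.trans he1
  set K : ℝ≥0 := (M + ‖g‖₊) ^ e + 1 with hK
  have hstep : ∀ S : Lp 𝕜 p μ, ∃ n, ‖S + (u n - g)‖ₑ ^ e ≤ ‖S‖ₑ ^ e + K := by
    intro S
    have h1 := eventually_enorm_add_rpow_le hp S (h := fun n => u n - g) (M := M + ‖g‖₊)
      (fun n => by
        refine (enorm_sub_le).trans ?_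
        push_cast
        exact add_le_add (hM n) le_rfl) (by
        filter_upwards [hlim, ae_all_iff.2 fun n => Lp.coeFn_sub (u n) g] with x hx hx'
        simp_rw [hx', Pi.sub_apply]
        simpa using hx.sub_const (g x))
    obtain ⟨n, hn⟩ := h1.exists
    refine ⟨n, hn.trans_eq ?_⟩
    rw [hK]
    push_cast
    rw [ENNReal.coe_rpow_of_nonneg _ he0.le]
    push_cast
    rfl
  -- `S` is a sum of `N` greedily chosen terms `u n - g`, each raising the `p`-th power of the norm
  -- by at most `K`.
  have hS : ∀ N : ℕ, ∃ S : Lp 𝕜 p μ, ‖S‖ₑ ^ e ≤ N * K ∧ S + (N : 𝕜) • g ∈ Y := by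
    intro N
    induction N with
    | zero => exact ⟨0, by simp [he0], by simp⟩
    | succ N ih =>
      obtain ⟨S, hS1, hS2⟩ := ih
      obtain ⟨n, hn⟩ := hstep S
      refine ⟨S + (u n - g), hn.trans ?_, ?_⟩
      · push_cast
        rw [add_mul, one_mul]
        gcongr
      · have : S + (u n - g) + ((N + 1 : ℕ) : 𝕜) • g = (S + (N : 𝕜) • g) + u n := by
          push_cast; rw [add_smul, one_smul]; abel
        rw [this]
        exact Y.add_mem hS2 (hu n)
  choose S hS1 hS2 using hS
  have hnorm : ∀ N : ℕ, ‖S N‖ ≤ (N : ℝ) ^ e⁻¹ * (K : ℝ) ^ e⁻¹ := by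
    intro N
    have h1 : ‖S N‖₊ ^ e ≤ N * K := by
      have := hS1 N
      rw [enorm_eq_nnnorm, ← ENNReal.coe_rpow_of_nonneg _ he0.le] at this
      exact_mod_cast this
    have h2 : ‖S N‖ ^ e ≤ N * K := by exact_mod_cast h1
    rw [← Real.mul_rpow (by positivity) (by positivity)]
    calc ‖S N‖ = (‖S N‖ ^ e) ^ e⁻¹ := (Real.rpow_rpow_inv (norm_nonneg _) he0.ne').symm
      _ ≤ _ := by gcongr
  -- These are arithmetic means of terms `u n`, at distance `O(N^(1/p - 1))` from `g`; this is where
  -- `p > 1` enters.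
  have hconv : Tendsto (fun N : ℕ => ((N : 𝕜)⁻¹) • S N + g) atTop (𝓝 g) := by
    have h1 : Tendsto (fun N : ℕ => ((N : 𝕜)⁻¹) • S N) atTop (𝓝 0) := by
      rw [tendsto_zero_iff_norm_tendsto_zero]
      have h2 : Tendsto (fun N : ℕ => (N : ℝ) ^ (-(1 - e⁻¹)) * (K : ℝ) ^ e⁻¹) atTop (𝓝 0) := by
        have h3 : 0 < 1 - e⁻¹ := by
          rw [sub_pos]; exact inv_lt_one_of_one_lt₀ he1
        simpa using ((tendsto_rpow_neg_atTop h3).comp tendsto_natCast_atTop_atTop).mul_const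
          ((K : ℝ) ^ e⁻¹)
      refine squeeze_zero' (Eventually.of_forall fun _ => norm_nonneg _) ?_ h2
      filter_upwards [eventually_gt_atTop 0] with N hN
      have hN' : (0 : ℝ) < N := by exact_mod_cast hN
      rw [norm_smul, norm_inv, RCLike.norm_natCast]
      calc (N : ℝ)⁻¹ * ‖S N‖ ≤ (N : ℝ)⁻¹ * ((N : ℝ) ^ e⁻¹ * (K : ℝ) ^ e⁻¹) := by
            gcongr; exact hnorm N
        _ = _ := by
            rw [neg_sub, Real.rpow_sub hN', Real.rpow_one]; field_simp
    simpa using h1.add_const g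
  refine hY.mem_of_tendsto hconv ?_
  filter_upwards [eventually_gt_atTop 0] with N hN
  have hN' : (N : 𝕜) ≠ 0 := by exact_mod_cast hN.ne'
  have : ((N : 𝕜)⁻¹) • S N + g = ((N : 𝕜)⁻¹) • (S N + (N : 𝕜) • g) := by
    rw [smul_add, smul_smul, inv_mul_cancel₀ hN', one_smul]
  rw [SetLike.mem_coe, this]
  exact Y.smul_mem _ (hS2 N)

end BanachSaks

/-! ### Extension by density to `L^p` -/

section Extension

variable {X : Type*} [MeasurableSpace X] {𝕜 : Type*} [RCLike 𝕜] {μ : Measure X}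
  {r p : ℝ≥0∞} [Fact (1 ≤ r)] [Fact (1 ≤ p)]

/-- The elements of `L^p` which also lie in `L^r`. -/
def interLp (𝕜 : Type*) [RCLike 𝕜] (μ : Measure X) (p r : ℝ≥0∞) [Fact (1 ≤ p)] :
    Submodule 𝕜 (Lp 𝕜 p μ) where
  carrier := {g | (g : X →ₘ[μ] 𝕜) ∈ Lp 𝕜 r μ}
  zero_mem' := (Lp 𝕜 r μ).zero_mem
  add_mem' ha hb := (Lp 𝕜 r μ).add_mem ha hb
  smul_mem' c _ ha := (Lp.LpSubmodule 𝕜 𝕜 r μ).smul_mem c ha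

omit [Fact (1 ≤ r)] in
theorem dense_interLp (hp : p ≠ ∞) : Dense (interLp 𝕜 μ p r : Set (Lp 𝕜 p μ)) :=
  (Lp.simpleFunc.dense (E := 𝕜) (μ := μ) hp).mono fun g hg =>
    Lp.mem_Lp_iff_memLp.2 (memLp_simpleFunc hp ⟨g, hg⟩)

theorem exists_extension (hp : p ≠ ∞) (V : Lp 𝕜 r μ →L[𝕜] Lp 𝕜 r μ) {C : ℝ≥0}
    (hV : ∀ f : Lp 𝕜 r μ, eLpNorm (V f) p μ ≤ C * eLpNorm f p μ) :
    ∃ S : Lp 𝕜 p μ →L[𝕜] Lp 𝕜 p μ, (∀ g, ‖S g‖ ≤ C * ‖g‖) ∧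
      ∀ (f : Lp 𝕜 r μ) (g : Lp 𝕜 p μ), (g : X →ₘ[μ] 𝕜) = f →
        (S g : X →ₘ[μ] 𝕜) = V f := by
  have hmem : ∀ g : interLp 𝕜 μ p r, (V ⟨g.1.1, g.2⟩ : X →ₘ[μ] 𝕜) ∈ Lp 𝕜 p μ := fun g =>
    Lp.mem_Lp_iff_eLpNorm_lt_top.2 ((hV _).trans_lt
      (ENNReal.mul_lt_top ENNReal.coe_lt_top (Lp.eLpNorm_lt_top g.1)))
  let W : interLp 𝕜 μ p r →ₗ[𝕜] Lp 𝕜 p μ :=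
    { toFun := fun g => ⟨V ⟨g.1.1, g.2⟩, hmem g⟩
      map_add' := fun a b => Subtype.ext (congrArg (fun f : Lp 𝕜 r μ => (f : X →ₘ[μ] 𝕜))
        (map_add V (⟨a.1.1, a.2⟩ : Lp 𝕜 r μ) ⟨b.1.1, b.2⟩))
      map_smul' := fun c a => Subtype.ext (congrArg (fun f : Lp 𝕜 r μ => (f : X →ₘ[μ] 𝕜))
        (map_smul V c (⟨a.1.1, a.2⟩ : Lp 𝕜 r μ))) }
  have hdense : DenseRange (interLp 𝕜 μ p r).subtype := by
    rw [DenseRange, Submodule.coe_subtype, Subtype.range_coe]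
    exact dense_interLp hp
  have hW : ∀ g, ‖W g‖ ≤ C * ‖(interLp 𝕜 μ p r).subtype g‖ := by
    intro g
    have h1 : ‖W g‖ₑ ≤ C * ‖(interLp 𝕜 μ p r).subtype g‖ₑ := by
      rw [Lp.enorm_def, Lp.enorm_def]
      exact hV _
    simp only [enorm_eq_nnnorm] at h1
    exact_mod_cast h1
  refine ⟨W.extendOfNorm (interLp 𝕜 μ p r).subtype,
    LinearMap.norm_extendOfNorm_apply_le hdense _ hW, fun f g hfg => ?_⟩
  have hg : g ∈ interLp 𝕜 μ p r := by
    change (g : X →ₘ[μ] 𝕜) ∈ Lp 𝕜 r μ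
    rw [hfg]; exact f.2
  have h1 := LinearMap.extendOfNorm_eq hdense ⟨C, hW⟩ ⟨g, hg⟩
  have h2 : (⟨g.1, hg⟩ : Lp 𝕜 r μ) = f := Subtype.ext hfg
  rw [show g = (interLp 𝕜 μ p r).subtype ⟨g, hg⟩ from rfl, h1]
  change (V ⟨g.1, hg⟩ : X →ₘ[μ] 𝕜) = V f
  rw [h2]

end Extension

/-! ### Convergence at time zero for boundedly supported functions -/

section Convergence

variable {X : Type*} [MetricSpace X] [MeasurableSpace X] [BorelSpace X]
  {𝕜 : Type*} [RCLike 𝕜] {μ : Measure X} {C₀ : ℝ≥0} {r : ℝ≥0∞} [Fact (1 ≤ r)]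
  {U : ℝ → Lp 𝕜 r μ →L[𝕜] Lp 𝕜 r μ} {a p q : ℝ≥0∞}

omit [MetricSpace X] [BorelSpace X] in
theorem eLpNorm_sub_eq_of_support {E : Set X} {q : ℝ≥0∞} {f g : X → 𝕜} (hE : MeasurableSet E)
    (hf : ∀ᵐ y ∂μ, y ∉ E → f y = 0) :
    eLpNorm (g - f) q (μ.restrict Eᶜ) = eLpNorm g q (μ.restrict Eᶜ) := by
  refine eLpNorm_congr_ae ?_
  filter_upwards [ae_restrict_of_ae hf, ae_restrict_mem hE.compl] with y hy hyE
  rw [Pi.sub_apply, hy hyE, sub_zero]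

theorem OffDiagonalLp.tendsto_eLpNorm_compl
    (hd : ∀ (x : X) (r : ℝ), 0 < r →
      μ (Metric.ball x (2 * r)) ≤ C₀ * μ (Metric.ball x r) ∧ μ (Metric.ball x r) < ∞)
    (hr : r ≠ ∞) (hp : 1 ≤ p) (hU : OffDiagonalLp U p p) {x : X} {ρ : ℝ} (hρ : 0 < ρ)
    {f : Lp 𝕜 r μ} (hf : ∀ᵐ y ∂μ, y ∉ Metric.ball x ρ → f y = 0) (hfp : MemLp f p μ) :
    Tendsto (fun t => eLpNorm (U t f - f : X → 𝕜) p (μ.restrict (Metric.ball x (4 * ρ))ᶜ))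
      (𝓝[>] 0) (𝓝 0) := by
  obtain ⟨m, hm, h⟩ := hU.exists_eLpNorm_compl_ball_le hd hr hp
  obtain ⟨K, hK, hK'⟩ := h x ρ hρ
  have hlim : Tendsto (fun t : ℝ => K * ENNReal.ofReal (√t ^ m) * eLpNorm f p μ)
      (𝓝[>] 0) (𝓝 0) := by
    have h1 : Tendsto (fun t : ℝ => ENNReal.ofReal (√t ^ m)) (𝓝[>] 0) (𝓝 0) := by
      have : Continuous fun t : ℝ => √t ^ m := by fun_prop
      have h2 := (ENNReal.tendsto_ofReal (this.tendsto 0)).mono_left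
        (nhdsWithin_le_nhds (s := Ioi 0))
      simpa [hm.ne'] using h2
    have h3 := ENNReal.Tendsto.mul_const (ENNReal.Tendsto.const_mul h1 (Or.inr hK))
      (b := eLpNorm f p μ) (Or.inr hfp.2.ne)
    simpa using h3
  have hf4 : ∀ᵐ y ∂μ, y ∉ Metric.ball x (4 * ρ) → f y = 0 := hf.mono fun y hy hyR =>
    hy fun hy' => hyR (Metric.ball_subset_ball (by linarith) hy')
  refine tendsto_of_tendsto_of_tendsto_of_le_of_le' tendsto_const_nhds hlim
    (Eventually.of_forall fun _ => zero_le) ?_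
  filter_upwards [self_mem_nhdsWithin] with t ht
  rw [eLpNorm_sub_eq_of_support measurableSet_ball hf4]
  exact hK' t ht f hf

theorem OffDiagonalLp.tendsto_eLpNorm_of_le
    (hd : ∀ (x : X) (r : ℝ), 0 < r →
      μ (Metric.ball x (2 * r)) ≤ C₀ * μ (Metric.ball x r) ∧ μ (Metric.ball x r) < ∞)
    (hr : r ≠ ∞) (hp : 1 ≤ p) (hpr : p ≤ r) (hU : OffDiagonalLp U p p)
    (hc : StronglyContinuousAtZero U) {x : X} {ρ : ℝ} (hρ : 0 < ρ)
    {f : Lp 𝕜 r μ} (hf : ∀ᵐ y ∂μ, y ∉ Metric.ball x ρ → f y = 0) (hfp : MemLp f p μ) :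
    Tendsto (fun t => eLpNorm (U t f - f : X → 𝕜) p μ) (𝓝[>] 0) (𝓝 0) := by
  have h1 := hU.tendsto_eLpNorm_compl hd hr hp hρ hf hfp
  have h2 : Tendsto (fun t => eLpNorm (U t f - f : X → 𝕜) r μ) (𝓝[>] 0) (𝓝 0) :=
    (Lp.tendsto_Lp_iff_tendsto_eLpNorm' _ _).1 (hc f)
  have hV : μ (Metric.ball x (4 * ρ)) ^ (1 / p.toReal - 1 / r.toReal) ≠ ∞ := by
    refine ENNReal.rpow_ne_top_of_nonneg (sub_nonneg.2 ?_) (hd x _ (by positivity)).2.ne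
    have hp' : 0 < p.toReal :=
      ENNReal.toReal_pos (zero_lt_one.trans_le hp).ne' (ne_top_of_le_ne_top hr hpr)
    exact one_div_le_one_div_of_le hp' (ENNReal.toReal_mono hr hpr)
  have h3 := (ENNReal.Tendsto.mul_const h2 (Or.inr hV)).add h1
  rw [zero_mul, zero_add] at h3
  refine tendsto_of_tendsto_of_tendsto_of_le_of_le tendsto_const_nhds h3
    (fun _ => zero_le) fun t => ?_
  have hm : AEStronglyMeasurable (U t f - f : X → 𝕜) μ :=
    (Lp.aestronglyMeasurable _).sub (Lp.aestronglyMeasurable _)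
  refine (eLpNorm_le_add_compl hp (E := Metric.ball x (4 * ρ)) measurableSet_ball hm).trans
    (add_le_add ?_ le_rfl)
  refine (eLpNorm_le_eLpNorm_mul_rpow_measure_univ hpr hm.restrict).trans ?_
  rw [Measure.restrict_apply_univ]
  exact mul_le_mul_left (eLpNorm_restrict_le _ _ _ _) _

omit [MetricSpace X] [BorelSpace X] in
theorem tendsto_eLpNorm_sub_of_interpolation (ha : 1 ≤ a) (hap : a < p) (hpq : p < q) {C : ℝ≥0}
    (hC : ∀ t, 0 < t → ∀ f : Lp 𝕜 r μ, eLpNorm (U t f) q μ ≤ C * eLpNorm f q μ)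
    {f : Lp 𝕜 r μ} (hfq : MemLp f q μ)
    (hlim : Tendsto (fun t => eLpNorm (U t f - f : X → 𝕜) a μ) (𝓝[>] 0) (𝓝 0)) :
    Tendsto (fun t => eLpNorm (U t f - f : X → 𝕜) p μ) (𝓝[>] 0) (𝓝 0) := by
  refine tendsto_eLpNorm_zero_of_interpolation ha hap hpq
    (fun t => (Lp.aestronglyMeasurable _).sub (Lp.aestronglyMeasurable _)) hlim
    (K := C * eLpNorm f q μ + eLpNorm f q μ)
    (ENNReal.add_ne_top.2 ⟨ENNReal.mul_ne_top ENNReal.coe_ne_top hfq.2.ne, hfq.2.ne⟩) ?_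
  filter_upwards [self_mem_nhdsWithin] with t ht
  refine (eLpNorm_sub_le (Lp.aestronglyMeasurable _) (Lp.aestronglyMeasurable _)
    (ha.trans (hap.trans hpq).le)).trans ?_
  gcongr
  exact hC t ht f

/-- `U t f - f` is small in `L^a` on `B(x, 4ρ)` and small in `L^p` outside. `U s` smooths the first
part, whose support is bounded, into `L^p`, and is bounded on `L^p` for the second. -/
theorem OffDiagonalLp.tendsto_eLpNorm_comp
    (hd : ∀ (x : X) (r : ℝ), 0 < r →
      μ (Metric.ball x (2 * r)) ≤ C₀ * μ (Metric.ball x r) ∧ μ (Metric.ball x r) < ∞)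
    (hr : r ≠ ∞) (hp : 1 ≤ p) (hU : OffDiagonalLp U a p)
    (hUp : OffDiagonalLp U p p) {C : ℝ≥0}
    (hC : ∀ t, 0 < t → ∀ f : Lp 𝕜 r μ, eLpNorm (U t f) p μ ≤ C * eLpNorm f p μ)
    {x : X} {ρ : ℝ} (hρ : 0 < ρ)
    {f : Lp 𝕜 r μ} (hf : ∀ᵐ y ∂μ, y ∉ Metric.ball x ρ → f y = 0) (hfp : MemLp f p μ)
    (hlim : Tendsto (fun t => eLpNorm (U t f - f : X → 𝕜) a μ) (𝓝[>] 0) (𝓝 0))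
    {s : ℝ} (hs : 0 < s) :
    Tendsto (fun t => eLpNorm (U s (U t f - f)) p μ) (𝓝[>] 0) (𝓝 0) := by
  obtain ⟨K, hK, hK'⟩ := hU.exists_eLpNorm_le_of_support hd hr hp x
    (by positivity : 0 < 4 * ρ) hs
  have h1 := hUp.tendsto_eLpNorm_compl hd hr hp hρ hf hfp
  have h2 := (ENNReal.Tendsto.const_mul hlim (Or.inr hK)).add
    (ENNReal.Tendsto.const_mul h1 (Or.inr (ENNReal.coe_ne_top (r := C))))
  simp only [mul_zero, add_zero] at h2
  refine tendsto_of_tendsto_of_tendsto_of_le_of_le tendsto_const_nhds h2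
    (fun _ => zero_le) fun t => ?_
  set w : Lp 𝕜 r μ := U t f - f with hw
  have hwc : w =ᵐ[μ] (U t f - f : X → 𝕜) := Lp.coeFn_sub _ _
  have hB : MeasurableSet (Metric.ball x (4 * ρ)) := measurableSet_ball
  have hsplit : w = truncLp hB w + truncLp hB.compl w := by
    rw [← truncLp_add_truncLp_of_disjoint hB hB.compl disjoint_compl_right]
    exact (truncLp_eq_self _ (Eventually.of_forall fun y hy => absurd (by simp) hy)).symm
  have e1 : eLpNorm (truncLp hB w) a μ ≤ eLpNorm (U t f - f : X → 𝕜) a μ :=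
    (eLpNorm_truncLp_le hB w a Measure.AbsolutelyContinuous.rfl).trans_eq (eLpNorm_congr_ae hwc)
  have e2 : eLpNorm (truncLp hB.compl w) p μ =
      eLpNorm (U t f - f : X → 𝕜) p (μ.restrict (Metric.ball x (4 * ρ))ᶜ) := by
    rw [eLpNorm_congr_ae (coeFn_truncLp hB.compl w),
      eLpNorm_indicator_eq_eLpNorm_restrict hB.compl]
    exact eLpNorm_congr_ae (ae_restrict_of_ae hwc)
  calc eLpNorm (U s w) p μ
      = eLpNorm (U s (truncLp hB w) + U s (truncLp hB.compl w) : X → 𝕜) p μ := by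
        conv_lhs => rw [hsplit, map_add]
        exact eLpNorm_congr_ae (Lp.coeFn_add _ _)
    _ ≤ eLpNorm (U s (truncLp hB w)) p μ + eLpNorm (U s (truncLp hB.compl w)) p μ :=
        eLpNorm_add_le (Lp.aestronglyMeasurable _) (Lp.aestronglyMeasurable _) hp
    _ ≤ _ := by
        refine add_le_add ?_ ?_
        · exact (hK' _ (truncLp_eq_zero hB w)).trans (mul_le_mul_right e1 _)
        · exact (hC s hs _).trans_eq (by rw [e2])

end Convergence

/-! ### Density and closedness for strong continuity -/

section Density

variable {X : Type*} [MetricSpace X] [MeasurableSpace X] [BorelSpace X]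
  {𝕜 : Type*} [RCLike 𝕜] {μ : Measure X} {p : ℝ≥0∞} [Fact (1 ≤ p)]

/-- Elements of `L^p` with bounded support which lie in all Lebesgue spaces are dense. -/
theorem dense_boundedSupport (hp : p ≠ ∞) (x : X) :
    Dense {g : Lp 𝕜 p μ | (∀ s, MemLp g s μ) ∧
      ∃ ρ : ℝ, 0 < ρ ∧ ∀ᵐ y ∂μ, y ∉ Metric.ball x ρ → g y = 0} := by
  refine dense_closure.1 ((Lp.simpleFunc.dense (E := 𝕜) (μ := μ) hp).mono fun g hg => ?_)
  refine mem_closure_of_tendsto (tendsto_truncLp hp (fun _ => measurableSet_ball)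
    (eventually_mem_ball_two_pow x one_pos) g) (Eventually.of_forall fun n => ⟨fun s => ?_, ?_⟩)
  · exact ((memLp_simpleFunc hp ⟨g, hg⟩).indicator measurableSet_ball).ae_eq
      (coeFn_truncLp measurableSet_ball g).symm
  · exact ⟨2 ^ (n + 2) * 1, by positivity, truncLp_eq_zero _ _⟩

theorem isClosed_setOf_tendsto {E : Type*} [NormedAddCommGroup E] [NormedSpace 𝕜 E]
    {S : ℝ → E →L[𝕜] E} {C : ℝ} (hC : 0 ≤ C) (hb : ∀ t, 0 < t → ∀ f, ‖S t f‖ ≤ C * ‖f‖) :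
    IsClosed {f : E | Tendsto (fun t => S t f) (𝓝[>] 0) (𝓝 f)} := by
  refine isClosed_of_closure_subset fun f hf => ?_
  rw [mem_ofPred_eq, Metric.tendsto_nhds]
  intro ε hε
  obtain ⟨g, hg, hfg⟩ := Metric.mem_closure_iff.1 hf (ε / (C + 2)) (by positivity)
  filter_upwards [self_mem_nhdsWithin, Metric.tendsto_nhds.1 hg (ε / (C + 2)) (by positivity)]
    with t ht hgt
  rw [dist_eq_norm] at hfg hgt ⊢
  have h1 : S t f - f = S t (f - g) + (S t g - g) + (g - f) := by rw [map_sub]; abel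
  have h2 := hb t ht (f - g)
  have h3 : C * ‖f - g‖ ≤ C * (ε / (C + 2)) := by gcongr
  calc ‖S t f - f‖ ≤ ‖S t (f - g)‖ + ‖S t g - g‖ + ‖g - f‖ := by
        rw [h1]; exact norm_add₃_le
    _ < C * (ε / (C + 2)) + ε / (C + 2) + ε / (C + 2) := by
        rw [norm_sub_rev g f]; linarith
    _ = ε := by field_simp; ring

/-- The elements on which a family of operators is strongly continuous at `0`. -/
def continuitySubmodule {E : Type*} [NormedAddCommGroup E] [NormedSpace 𝕜 E]
    (S : ℝ → E →L[𝕜] E) : Submodule 𝕜 E where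
  carrier := {f | Tendsto (fun t => S t f) (𝓝[>] 0) (𝓝 f)}
  zero_mem' := by simp
  add_mem' {a b} ha hb := (Tendsto.add ha hb).congr fun t => (map_add _ _ _).symm
  smul_mem' c a ha := (Tendsto.const_smul ha c).congr fun t => (map_smul _ _ _).symm

end Density

/-! ### Strong continuity on `L^p` -/

section Main

variable {X : Type*} [MetricSpace X] [Nonempty X] [MeasurableSpace X] [BorelSpace X]
  {𝕜 : Type*} [RCLike 𝕜] {μ : Measure X}
  {B : Type*} [NormedAddCommGroup B] [NormedSpace 𝕜 B] {ι : FunctionSpace 𝕜 μ B}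
  {T : ℝ → B →L[𝕜] B} {r p : ℝ≥0∞} [Fact (1 ≤ r)] [Fact (1 ≤ p)]

omit [Nonempty X] in
theorem OffDiagonal.offDiagonalLp_self {U : ℝ → Lp 𝕜 r μ →L[𝕜] Lp 𝕜 r μ} {a q s : ℝ≥0∞}
    (h : OffDiagonal ι T a q) (hr : r ≠ ∞) (hU : IsLpExtension ι T r U) (ha : 1 ≤ a)
    (has : a ≤ s) (hsq : s ≤ q) : OffDiagonalLp U s s :=
  h.offDiagonalLp hr hU ha has (ha.trans has) hsq

theorem exists_isStronglyContinuousExtension (hμ : IsDoubling μ) (hr : r ≠ ∞)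
    {U : ℝ → Lp 𝕜 r μ →L[𝕜] Lp 𝕜 r μ} (hU : IsStronglyContinuousExtension ι T r U)
    (hpJ : p ∈ offDiagonalSet ι T) (hp : p ≠ ∞) :
    ∃ (S : ℝ → Lp 𝕜 p μ →L[𝕜] Lp 𝕜 p μ) (C : ℝ≥0), IsStronglyContinuousExtension ι T p S ∧
      ∀ t, 0 < t → ∀ f, ‖S t f‖ ≤ C * ‖f‖ := by
  obtain ⟨C₀, hd⟩ := hμ
  have hp1 : 1 ≤ p := Fact.out
  have hr1 : 1 ≤ r := Fact.out
  obtain ⟨hUext, hUsem, hUcont⟩ := hU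
  have hpp : OffDiagonalLp U p p := by
    obtain ⟨a, q, ha, haq, h, rfl | rfl⟩ := hpJ
    · exact h.offDiagonalLp_self hr hUext ha le_rfl haq.le
    · exact h.offDiagonalLp_self hr hUext ha haq.le le_rfl
  obtain ⟨C, hC⟩ := hpp.exists_eLpNorm_le hd hr hp1
  have hex : ∀ t : ℝ, ∃ S : Lp 𝕜 p μ →L[𝕜] Lp 𝕜 p μ, 0 < t → (∀ g, ‖S g‖ ≤ C * ‖g‖) ∧
      ∀ (f : Lp 𝕜 r μ) (g : Lp 𝕜 p μ), (g : X →ₘ[μ] 𝕜) = f → (S g : X →ₘ[μ] 𝕜) = U t f := by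
    intro t
    by_cases ht : 0 < t
    · obtain ⟨S, hS⟩ := exists_extension hp (U t) (hC t ht)
      exact ⟨S, fun _ => hS⟩
    · exact ⟨0, fun h => absurd h ht⟩
  choose S hS using hex
  have hSb : ∀ t, 0 < t → ∀ g, ‖S t g‖ ≤ C * ‖g‖ := fun t ht => (hS t ht).1
  have hSU : ∀ t, 0 < t → ∀ (f : Lp 𝕜 r μ) (g : Lp 𝕜 p μ), (g : X →ₘ[μ] 𝕜) = f →
      (S t g : X →ₘ[μ] 𝕜) = U t f := fun t ht => (hS t ht).2
  have hsem : IsSemigroup S := by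
    intro s t hs ht
    refine ContinuousLinearMap.ext fun g => ?_
    refine (dense_interLp (r := r) hp).induction (P := fun g => ((S s).comp (S t)) g = S (s + t) g)
      (fun g hg => ?_) (isClosed_eq (by fun_prop) (by fun_prop)) g
    have h1 := hSU t ht ⟨g.1, hg⟩ g rfl
    refine Subtype.ext ?_
    change (S s (S t g) : X →ₘ[μ] 𝕜) = S (s + t) g
    rw [hSU s hs _ _ h1, hSU (s + t) (add_pos hs ht) ⟨g.1, hg⟩ g rfl, ← hUsem s t hs ht]
    rfl
  refine ⟨S, C, ⟨?_, hsem, ?_⟩, hSb⟩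
  · intro t ht f hf g hgf
    have hfr : ι.toFun f ∈ Lp 𝕜 r μ := Lp.mem_Lp_iff_memLp.2 (hf r hr1)
    rw [hSU t ht ⟨ι.toFun f, hfr⟩ g hgf]
    exact hUext t ht f hf _ rfl
  let x₀ : X := Classical.arbitrary X
  have hY : IsClosed (continuitySubmodule S : Set (Lp 𝕜 p μ)) :=
    isClosed_setOf_tendsto C.2 hSb
  suffices hnice : {g : Lp 𝕜 p μ | (∀ s, MemLp g s μ) ∧
      ∃ ρ : ℝ, 0 < ρ ∧ ∀ᵐ y ∂μ, y ∉ Metric.ball x₀ ρ → g y = 0} ⊆ continuitySubmodule S by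
    intro f
    have h1 : (univ : Set (Lp 𝕜 p μ)) ⊆ continuitySubmodule S := by
      rw [← (dense_boundedSupport hp x₀).closure_eq]
      exact closure_minimal hnice hY
    exact h1 (mem_univ f)
  rintro g ⟨hg, ρ, hρ, hgρ⟩
  have hgr : (g : X →ₘ[μ] 𝕜) ∈ Lp 𝕜 r μ := Lp.mem_Lp_iff_memLp.2 (hg r)
  set f : Lp 𝕜 r μ := ⟨g.1, hgr⟩ with hf
  have hfg : (g : X →ₘ[μ] 𝕜) = f := rfl
  have hfin : Tendsto (fun t => eLpNorm (U t f - f : X → 𝕜) p μ) (𝓝[>] 0) (𝓝 0) →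
      g ∈ continuitySubmodule S := by
    intro h
    refine (Lp.tendsto_Lp_iff_tendsto_eLpNorm' _ _).2 (h.congr' ?_)
    filter_upwards [self_mem_nhdsWithin] with t ht
    rw [hSU t ht f g hfg, hfg]
  rcases le_or_gt p r with hpr | hrp
  · exact hfin (hpp.tendsto_eLpNorm_of_le hd hr hp1 hpr hUcont hρ hgρ (hg p))
  have hlimr : Tendsto (fun t => eLpNorm (U t f - f : X → 𝕜) r μ) (𝓝[>] 0) (𝓝 0) :=
    (Lp.tendsto_Lp_iff_tendsto_eLpNorm' _ _).1 (hUcont f)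
  obtain ⟨a, q, ha, haq, h, hpaq⟩ := hpJ
  -- As lower endpoint, `p` lies strictly between `r` and `q`, so interpolation applies. As upper
  -- endpoint it has no partner above it, and the argument goes through `L^a`.
  rcases hpaq with rfl | rfl
  · obtain ⟨D, hD⟩ := (h.offDiagonalLp_self hr hUext ha haq.le le_rfl).exists_eLpNorm_le hd hr
      (ha.trans haq.le)
    exact hfin (tendsto_eLpNorm_sub_of_interpolation hr1 hrp haq hD (hg q) hlimr)
  · have hlima : Tendsto (fun t => eLpNorm (U t f - f : X → 𝕜) a μ) (𝓝[>] 0) (𝓝 0) := by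
      rcases le_or_gt a r with har | hra
      · exact (h.offDiagonalLp_self hr hUext ha le_rfl haq.le).tendsto_eLpNorm_of_le hd hr ha har
          hUcont hρ hgρ (hg a)
      · exact tendsto_eLpNorm_sub_of_interpolation hr1 hra haq hC (hg p) hlimr
    have hap := h.offDiagonalLp hr hUext ha le_rfl hp1 le_rfl
    have hmem : ∀ s, 0 < s → S s g ∈ continuitySubmodule S := by
      intro s hs
      have h1 := hap.tendsto_eLpNorm_comp hd hr hp1 hpp hC hρ hgρ (hg p) hlima hs
      refine (Lp.tendsto_Lp_iff_tendsto_eLpNorm' _ _).2 (h1.congr' ?_)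
      filter_upwards [self_mem_nhdsWithin] with t ht
      -- Commuting the two operators lets the smoothing `U s` act on `U t f - f`.
      have e1 : (S t (S s g) : X →ₘ[μ] 𝕜) = U s (U t f) := by
        rw [hSU t ht _ _ (hSU s hs f g hfg)]
        have := (hUsem t s ht hs).trans ((congrArg U (add_comm t s)).trans (hUsem s t hs ht).symm)
        exact congrArg (fun V : Lp 𝕜 r μ →L[𝕜] Lp 𝕜 r μ => (V f : X →ₘ[μ] 𝕜)) this
      rw [e1, hSU s hs f g hfg, map_sub]
      exact eLpNorm_congr_ae (Lp.coeFn_sub _ _)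
    -- Strong continuity on `L^r` identifies the almost everywhere limit as `g`, without any
    -- convergence in `L^p`.
    obtain ⟨t, ht0, ht⟩ : ∃ t : ℕ → ℝ, (∀ n, 0 < t n) ∧
        ∀ᵐ x ∂μ, Tendsto (fun n => U (t n) f x) atTop (𝓝 (f x)) := by
      have h1 : Tendsto (fun n : ℕ => (1 : ℝ) / (n + 1)) atTop (𝓝[>] 0) :=
        tendsto_nhdsWithin_iff.2 ⟨tendsto_one_div_add_atTop_nhds_zero_nat,
          Eventually.of_forall fun n => mem_Ioi.2 (by positivity)⟩
      obtain ⟨φ, -, hφ⟩ :=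
        (tendstoInMeasure_of_tendsto_Lp ((hUcont f).comp h1)).exists_seq_tendsto_ae
      exact ⟨fun n => 1 / (φ n + 1), fun n => by positivity, hφ⟩
    refine mem_of_tendsto_ae_of_bounded (ha.trans_lt haq) hp _ hY (fun n => hmem (t n) (ht0 n))
      (M := C * ‖g‖₊) (fun n => ?_) ?_
    · have := hSb (t n) (ht0 n) g
      rw [enorm_eq_nnnorm]
      exact_mod_cast this
    · filter_upwards [ht] with x hx
      simp_rw [hSU _ (ht0 _) f g hfg]
      exact hx

end Main

end OffDiag

theorem mainTheorem10 {X : Type*} [MetricSpace X] [Nonempty X] [MeasurableSpace X] [BorelSpace X]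
    (μ : Measure X) (hμ : OffDiag.IsDoubling μ)
    {𝕜 : Type*} [RCLike 𝕜]
    {B : Type*} [NormedAddCommGroup B] [NormedSpace 𝕜 B] [CompleteSpace B]
    (ι : OffDiag.FunctionSpace 𝕜 μ B)
    (T : ℝ → B →L[𝕜] B) (hT : OffDiag.IsSemigroup T)
    (p₀ q₀ : ℝ≥0∞) (hp₀ : 1 ≤ p₀) (hpq₀ : p₀ < q₀) (hoff : OffDiag.OffDiagonal ι T p₀ q₀)
    (r : ℝ≥0∞) [Fact (1 ≤ r)] (hr : r ∈ OffDiag.offDiagonalSet ι T) (hr_fin : r ≠ ∞)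
    (hcont : ∃ S : ℝ → Lp 𝕜 r μ →L[𝕜] Lp 𝕜 r μ, OffDiag.IsStronglyContinuousExtension ι T r S) :
    ∀ (p : ℝ≥0∞) [Fact (1 ≤ p)], p ∈ OffDiag.offDiagonalSet ι T → p ≠ ∞ →
      ∃ S : ℝ → Lp 𝕜 p μ →L[𝕜] Lp 𝕜 p μ,
        OffDiag.IsStronglyContinuousExtension ι T p S ∧
        ∃ A : Lp 𝕜 p μ →ₗ.[𝕜] Lp 𝕜 p μ,
          OffDiag.IsGenerator S A ∧ Dense (A.domain : Set (Lp 𝕜 p μ)) ∧ A.IsClosed := by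
  intro p _ hpJ hp
  obtain ⟨U, hU⟩ := hcont
  obtain ⟨S, C, hS, hb⟩ := OffDiag.exists_isStronglyContinuousExtension hμ hr_fin hU hpJ hp
  -- The bound must be at least `1` so as to cover the identity at time zero.
  have hb' : ∀ t, 0 < t → ∀ f, ‖S t f‖ ≤ (C + 1 : ℝ) * ‖f‖ := fun t ht f =>
    (hb t ht f).trans (by gcongr; linarith)
  exact ⟨S, hS, OffDiag.exists_generator hS.isSemigroup hS.stronglyContinuous
    (by linarith [C.2] : (1 : ℝ) ≤ C + 1) hb'⟩
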